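/- Let $R$ be a complete, separated topological associative unital ring with a base of neighborhoods of zero formed by open right ideals. For a complete, separated topological abelian group $A$ with a base of neighborhoods of zero formed by open subgroups and a set $X$, let $A[[X]]$ be the group of all formal linear combinations $\sum_{x\in X}a_x x$ whose family of coefficients $a_x\in A$ converges to zero (every open subgroup of $A$ contains all but finitely many of the $a_x$). The functor $X\mapsto R[[X]]$ is a monad on the category of sets, with the point measures as unit and the opening of parentheses as multiplication; a left $R$-contramodule is an algebra $\pi_C\colon R[[C]]\to C$ over this monad. Every left $R$-contramodule is in particular a left $R$-module, the left $R$-contramodules form an abelian category, and "projective" means a projective object of this category. A right $R$-module $N$ is discrete if the annihilator of each of its elements is open in $R$. For a discrete right $R$-module $N$ and a left $R$-contramodule $C$, the contratensor product $N\odot_R C$ is the cokernel of the difference of the two maps $N\otimes_{\mathbb Z}R[[C]]\rightrightarrows N\otimes_{\mathbb Z}C$ given by $b\otimes\sum_c r_c c\mapsto b\otimes\pi_C(\sum_c r_c c)$ and $b\otimes\sum_c r_c c\mapsto\sum_c br_c\otimes c$ (a finite sum). A left $R$-contramodule $F$ is flat if the functor $N\mapsto N\odot_R F$ from discrete right $R$-modules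 to abelian groups is exact. Let $H\subset R$ be a closed two-sided ideal that is (a) strongly closed: the quotient $R/H$ is complete in the quotient topology and, for every set $X$, the induced map $R[[X]]\to(R/H)[[X]]$ is surjective; and (b) topologically left T-nilpotent: for every sequence $a_1,a_2,a_3,\dots$ of elements of $H$, the sequence $a_1,\ a_1a_2,\ a_1a_2a_3,\dots$ converges to zero in $R$. For a left $R$-contramodule $C$, let $H\rightthreetimes C\subset C$ be the image of $H[[C]]\subset R[[C]]$ under $\pi_C$. Then the quotient $C/(H\rightthreetimes C)$ has a unique left contramodule structure over the topological ring $R/H$ for which the projection $C\to C/(H\rightthreetimes C)$ is compatible with the contraactions along $R\to R/H$. Theorem. Let $F$ be a flat left $R$-contramodule. Then the left $R$-contramodule $F$ is projective if and only if the left $R/H$-contramodule $F/(H\rightthreetimes F)$ is projective. -/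

import Mathlib

universe u

namespace ContramoduleTheory

open Filter Topology TensorProduct

set_option linter.unusedSectionVars false

/-! ### Topological rings with a base of open right ideals -/

/-- A complete, separated topological ring in which open right ideals form a base of
neighborhoods of zero. Right ideals are the `Rᵐᵒᵖ`-submodules of `R`, and completeness refers to
the canonical uniform structure of the additive topological group of `R`. -/
class IsContramoduleRing (R : Type*) [Ring R] [TopologicalSpace R] : Prop extends
    IsTopologicalRing R, T2Space R, IsLinearTopology Rᵐᵒᵖ R where
  complete : @CompleteSpace R (IsTopologicalAddGroup.rightUniformSpace R)

section Convergence

theorem right_ideal_mul_mem {R : Type*} [Ring R] (I : Submodule Rᵐᵒᵖ R) {a : R} (ha : a ∈ I) (b : R) : a * b ∈ I := by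
  simpa using I.smul_mem (MulOpposite.op b) ha

theorem tsum_mem_of_isClosed {R : Type*} [Ring R] [TopologicalSpace R] {ι : Type*} {f : ι → R}
    {H : AddSubgroup R}
    (hH : IsClosed (H : Set R)) (hf : ∀ i, f i ∈ H) : ∑' i, f i ∈ H := by
  by_cases hs : Summable f
  · exact hH.mem_of_tendsto hs.hasSum (Eventually.of_forall fun s => sum_mem fun i _ => hf i)
  · rw [tsum_eq_zero_of_not_summable hs]; exact H.zero_mem

variable {R : Type*} [Ring R] [TopologicalSpace R] [IsContramoduleRing R]

theorem exists_open_right_ideal {U : Set R} (hU : U ∈ 𝓝 (0 : R)) :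
    ∃ I : Submodule Rᵐᵒᵖ R, IsOpen (I : Set R) ∧ (I : Set R) ⊆ U := by
  obtain ⟨I, hI, hIU⟩ := (IsLinearTopology.hasBasis_open_submodule Rᵐᵒᵖ).mem_iff.1 hU
  exact ⟨I, hI, hIU⟩

instance : NonarchimedeanRing R where
  is_nonarchimedean U hU := by
    obtain ⟨I, hI, hIU⟩ := exists_open_right_ideal hU
    exact ⟨⟨I.toAddSubgroup, hI⟩, hIU⟩

theorem summable_of_tendsto_zero {ι : Type*} {f : ι → R} (hf : Tendsto f cofinite (𝓝 0)) :
    Summable f := by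
  let : UniformSpace R := IsTopologicalAddGroup.rightUniformSpace R
  have : IsUniformAddGroup R := isUniformAddGroup_of_addCommGroup
  have : CompleteSpace R := IsContramoduleRing.complete
  exact NonarchimedeanAddGroup.summable_of_tendsto_cofinite_zero hf

theorem tendsto_zero_iff {ι : Type*} {f : ι → R} :
    Tendsto f cofinite (𝓝 0) ↔
      ∀ I : Submodule Rᵐᵒᵖ R, IsOpen (I : Set R) → {i | f i ∉ I}.Finite := by
  rw [(IsLinearTopology.hasBasis_open_submodule Rᵐᵒᵖ).tendsto_right_iff]
  rfl

theorem tendsto_mul_right_zero {ι : Type*} {f : ι → R} (hf : Tendsto f cofinite (𝓝 0))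
    (g : ι → R) : Tendsto (fun i => f i * g i) cofinite (𝓝 0) := by
  rw [tendsto_zero_iff] at hf ⊢
  exact fun I hI => (hf I hI).subset fun i hi h => hi (right_ideal_mul_mem I h _)

theorem exists_mul_mem (I : Submodule Rᵐᵒᵖ R) (hI : IsOpen (I : Set R)) (r : R) :
    ∃ J : Submodule Rᵐᵒᵖ R, IsOpen (J : Set R) ∧ ∀ a ∈ J, r * a ∈ I := by
  have : (fun a => r * a) ⁻¹' (I : Set R) ∈ 𝓝 (0 : R) :=
    (continuous_const_mul r).continuousAt.preimage_mem_nhds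
      (by simpa using hI.mem_nhds (by simp))
  obtain ⟨J, hJ, h⟩ := exists_open_right_ideal this
  exact ⟨J, hJ, fun a ha => h ha⟩

theorem tendsto_uncurry_zero {Y X : Type*} {a : Y → R} (ha : Tendsto a cofinite (𝓝 0))
    {b : Y → X → R} (hb : ∀ y, Tendsto (b y) cofinite (𝓝 0)) :
    Tendsto (fun p : Y × X => a p.1 * b p.1 p.2) cofinite (𝓝 0) := by
  rw [tendsto_zero_iff] at ha ⊢
  intro I hI
  have key : ∀ y, {x | a y * b y x ∉ I}.Finite := by
    intro y
    obtain ⟨J, hJ, h⟩ := exists_mul_mem I hI (a y)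
    exact (tendsto_zero_iff.1 (hb y) J hJ).subset fun x hx hxJ => hx (h _ hxJ)
  refine ((ha I hI).biUnion fun y _ => (key y).image (Prod.mk y)).subset ?_
  rintro ⟨y, x⟩ h
  simp only [Set.mem_iUnion]
  exact ⟨y, fun hy => h (right_ideal_mul_mem I hy _), x, h, rfl⟩

theorem tendsto_bind_zero {Y X : Type*} {a : Y → R} (ha : Tendsto a cofinite (𝓝 0))
    {b : Y → X → R} (hb : ∀ y, Tendsto (b y) cofinite (𝓝 0)) :
    Tendsto (fun x => ∑' y, a y * b y x) cofinite (𝓝 0) := by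
  have h2 := tendsto_uncurry_zero ha hb
  rw [tendsto_zero_iff] at h2 ⊢
  intro I hI
  refine ((h2 I hI).image Prod.snd).subset fun x hx => ?_
  by_contra hcon
  refine hx (tsum_mem_of_isClosed (H := I.toAddSubgroup)
    (AddSubgroup.isClosed_of_isOpen _ hI) fun y => ?_)
  by_contra hy
  exact hcon ⟨(y, x), hy, rfl⟩

end Convergence

/-! ### Convergent formal linear combinations -/

/-- The group `A[[X]]` of all formal linear combinations `∑ aₓ x` of elements of `X` whose
coefficients form an `X`-indexed family converging to zero in `A`, that is, every neighborhood of
zero contains all but finitely many of them. -/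
def formalSums (A X : Type*) [AddCommGroup A] [TopologicalSpace A] [IsTopologicalAddGroup A] :
    AddSubgroup (X → A) where
  carrier := {a | Tendsto a cofinite (𝓝 0)}
  zero_mem' := tendsto_const_nhds
  add_mem' ha hb := by simpa using! Tendsto.add ha hb
  neg_mem' ha := by simpa using! Tendsto.neg ha

/-- `A[[X]]` as a type. -/
abbrev FormalSum (A X : Type*) [AddCommGroup A] [TopologicalSpace A] [IsTopologicalAddGroup A] :
    Type _ :=
  formalSums A X

namespace FormalSum

section Monad

variable {R : Type*} [Ring R] [TopologicalSpace R] [IsContramoduleRing R]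
variable {X Y Z : Type*}

@[ext]
theorem ext {a b : FormalSum R X} (h : ∀ x, a.1 x = b.1 x) : a = b := Subtype.ext (funext h)

/-- The functoriality `R[[f]] : R[[X]] → R[[Y]]`, which takes `∑ aₓ x` to the formal linear
combination with the coefficient `∑_{f(x) = y} aₓ` at `y`. -/
noncomputable def coeffMap (f : X → Y) (a : X → R) (y : Y) : R := ∑' x : {x // f x = y}, a x

open Classical in
/-- The monad unit `X → R[[X]]` (the point measures). -/
noncomputable def single (x : X) : FormalSum R X :=
  ⟨Pi.single x 1, tendsto_zero_iff.2 fun I _ => (Set.finite_singleton x).subset fun y hy => by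
    by_contra h
    exact hy (by simp [Pi.single_eq_of_ne h])⟩

/-- The substitution of a formal linear combination `b y ∈ R[[X]]` for every formal variable `y` in
`∑ a_y y ∈ R[[Y]]`, with opening of the parentheses: the coefficient at `x` of the result is
`∑_y a_y b_{y,x}`. -/
noncomputable def bind (a : FormalSum R Y) (b : Y → FormalSum R X) : FormalSum R X :=
  ⟨fun x => ∑' y, a.1 y * (b y).1 x, tendsto_bind_zero a.2 fun y => (b y).2⟩

theorem coeffMap_eq_bind (f : X → Y) (a : FormalSum R X) :
    coeffMap f a.1 = (bind a fun x => single (f x)).1 := by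
  classical
  funext y
  change ∑' x : {x | f x = y}, a.1 x = ∑' x, a.1 x * (single (R := R) (f x)).1 y
  rw [tsum_subtype {x | f x = y} a.1]
  refine tsum_congr fun x => ?_
  by_cases h : f x = y
  · subst h
    simp [single]
  · simp [single, h, Ne.symm h]

/-- The map `R[[f]] : R[[X]] → R[[Y]]` induced by a map of sets `f : X → Y`. -/
noncomputable def map (f : X → Y) (a : FormalSum R X) : FormalSum R Y :=
  ⟨coeffMap f a.1, by rw [coeffMap_eq_bind]; exact (bind a fun x => single (f x)).2⟩

/-- The monad multiplication `R[[R[[X]]]] → R[[X]]` (opening of parentheses): the coefficient at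
`x` of the image of `∑_y r_y y` is `∑_y r_y y_x`, where `y` ranges over `R[[X]]`. -/
noncomputable def join (r : FormalSum R (FormalSum R X)) : FormalSum R X :=
  bind r id

theorem map_eq_bind (f : X → Y) (a : FormalSum R X) : map f a = bind a fun x => single (f x) :=
  Subtype.ext (coeffMap_eq_bind f a)

theorem summable_bind (a : FormalSum R Y) (b : Y → R) : Summable fun y => a.1 y * b y :=
  summable_of_tendsto_zero (tendsto_mul_right_zero a.2 b)

theorem single_bind (y : Y) (b : Y → FormalSum R X) : bind (single y) b = b y := by
  classical
  ext x
  change ∑' z, (single (R := R) y).1 z * (b z).1 x = _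
  rw [tsum_eq_single y]
  · simp [single]
  · intro z hz
    simp [single, Pi.single_eq_of_ne hz]

theorem bind_single (a : FormalSum R X) : bind a single = a := by
  classical
  ext x
  change ∑' z, a.1 z * (single (R := R) z).1 x = _
  rw [tsum_eq_single x]
  · simp [single]
  · intro z hz
    simp [single, Pi.single_eq_of_ne hz.symm]

theorem bind_assoc (a : FormalSum R Z) (b : Z → FormalSum R Y) (c : Y → FormalSum R X) :
    bind (bind a b) c = bind a fun z => bind (b z) c := by
  ext x
  change ∑' y, (∑' z, a.1 z * (b z).1 y) * (c y).1 x =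
    ∑' z, a.1 z * ∑' y, (b z).1 y * (c y).1 x
  have h1 : ∀ y, (∑' z, a.1 z * (b z).1 y) * (c y).1 x =
      ∑' z, a.1 z * (b z).1 y * (c y).1 x := fun y =>
    ((summable_bind a fun z => (b z).1 y).tsum_mul_right _).symm
  have h2 : ∀ z, a.1 z * ∑' y, (b z).1 y * (c y).1 x =
      ∑' y, a.1 z * (b z).1 y * (c y).1 x := fun z => by
    rw [← (summable_bind (b z) fun y => (c y).1 x).tsum_mul_left]
    simp [mul_assoc]
  simp_rw [h1, h2]
  let : UniformSpace R := IsTopologicalAddGroup.rightUniformSpace R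
  have : IsUniformAddGroup R := isUniformAddGroup_of_addCommGroup
  have : CompleteSpace R := IsContramoduleRing.complete
  refine Summable.tsum_comm (f := fun z y => a.1 z * (b z).1 y * (c y).1 x) ?_
  exact summable_of_tendsto_zero (tendsto_mul_right_zero
    (tendsto_uncurry_zero a.2 fun z => (b z).2) fun p => (c p.2).1 x)

theorem bind_add (a a' : FormalSum R Y) (b : Y → FormalSum R X) :
    bind (a + a') b = bind a b + bind a' b := by
  ext x
  change ∑' y, (a.1 y + a'.1 y) * (b y).1 x = _
  simp_rw [add_mul]
  exact (summable_bind a _).tsum_add (summable_bind a' _)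

theorem bind_sub_right (a : FormalSum R Y) (b b' : Y → FormalSum R X) :
    bind a (fun y => b y - b' y) = bind a b - bind a b' := by
  ext x
  change ∑' y, a.1 y * ((b y).1 x - (b' y).1 x) = _
  simp_rw [mul_sub]
  exact (summable_bind a _).tsum_sub (summable_bind a _)

/-- `bind` as an additive homomorphism in the first argument. -/
noncomputable def bindHom (b : Y → FormalSum R X) : FormalSum R Y →+ FormalSum R X :=
  AddMonoidHom.mk' (fun a => bind a b) fun a a' => bind_add a a' b

theorem bind_zero (b : Y → FormalSum R X) : bind (0 : FormalSum R Y) b = 0 :=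
  (bindHom b).map_zero

theorem bind_neg (a : FormalSum R Y) (b : Y → FormalSum R X) : bind (-a) b = -bind a b :=
  (bindHom b).map_neg a

theorem bind_sub (a a' : FormalSum R Y) (b : Y → FormalSum R X) :
    bind (a - a') b = bind a b - bind a' b :=
  (bindHom b).map_sub a a'

theorem bind_nsmul (n : ℕ) (a : FormalSum R Y) (b : Y → FormalSum R X) :
    bind (n • a) b = n • bind a b :=
  (bindHom b).map_nsmul n a

theorem bind_zsmul (n : ℤ) (a : FormalSum R Y) (b : Y → FormalSum R X) :
    bind (n • a) b = n • bind a b :=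
  (bindHom b).map_zsmul n a

theorem map_single (f : X → Y) (x : X) : map f (single x : FormalSum R X) = single (f x) := by
  rw [map_eq_bind, single_bind]

theorem map_map (f : X → Y) (g : Y → Z) (a : FormalSum R X) :
    map g (map f a) = map (fun x => g (f x)) a := by
  simp only [map_eq_bind, bind_assoc, single_bind]

theorem map_id (a : FormalSum R X) : map (fun x => x) a = a := by
  rw [map_eq_bind, bind_single]

theorem map_bind (a : FormalSum R Z) (b : Z → FormalSum R X) (f : X → Y) :
    map f (bind a b) = bind a fun z => map f (b z) := by
  simp only [map_eq_bind, bind_assoc]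

theorem bind_map (a : FormalSum R Z) (f : Z → Y) (b : Y → FormalSum R X) :
    bind (map f a) b = bind a fun z => b (f z) := by
  simp only [map_eq_bind, bind_assoc, single_bind]

theorem join_map (a : FormalSum R Y) (b : Y → FormalSum R X) : join (map b a) = bind a b :=
  bind_map a b id

theorem map_sub (f : X → Y) (a b : FormalSum R X) : map f (a - b) = map f a - map f b := by
  simp only [map_eq_bind, bind_sub]

end Monad

end FormalSum

/-! ### Left contramodules -/

/-- A left `R`-contramodule: an algebra over the monad `X ↦ R[[X]]` on the category of sets, that
is, a set `C` with a contraaction map `R[[C]] → C` that satisfies the contraunitality and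
contraassociativity equations. -/
structure LeftContramodule (R : Type u) [Ring R] [TopologicalSpace R] [IsContramoduleRing R] where
  /-- The underlying set. -/
  carrier : Type u
  /-- The left contraaction map. -/
  act : FormalSum R carrier → carrier
  act_single : ∀ c, act (FormalSum.single c) = c
  act_join : ∀ r : FormalSum R (FormalSum R carrier),
    act (FormalSum.join r) = act (FormalSum.map act r)

namespace LeftContramodule

open FormalSum

variable {R : Type u} [Ring R] [TopologicalSpace R] [IsContramoduleRing R]

instance : CoeSort (LeftContramodule R) (Type u) := ⟨carrier⟩

/-- A morphism of left contramodules: a map that commutes with the contraactions. -/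
@[ext]
structure Hom (C D : LeftContramodule R) where
  /-- The underlying map. -/
  toFun : C → D
  map_act : ∀ r : FormalSum R C, toFun (C.act r) = D.act (FormalSum.map toFun r)

/-- The category of left `R`-contramodules. -/
instance : CategoryTheory.Category (LeftContramodule R) where
  Hom := Hom
  id C := ⟨fun c => c, fun r => by rw [FormalSum.map_id]⟩
  comp f g := ⟨fun c => g.toFun (f.toFun c), fun r => by
    rw [f.map_act, g.map_act, FormalSum.map_map]⟩

variable (C : LeftContramodule R)

/-! The additive group of a contramodule, with `a + b = act (1·a + 1·b)`. -/

instance : Zero C := ⟨C.act 0⟩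
noncomputable instance : Add C := ⟨fun a b => C.act (single a + single b)⟩
noncomputable instance : Neg C := ⟨fun a => C.act (-single a)⟩
noncomputable instance : Sub C := ⟨fun a b => C.act (single a - single b)⟩
noncomputable instance : SMul ℕ C := ⟨fun n a => C.act (n • single a)⟩
noncomputable instance : SMul ℤ C := ⟨fun n a => C.act (n • single a)⟩

variable {C}

theorem act_bind {Y : Type*} (a : FormalSum R Y) (b : Y → FormalSum R C) :
    C.act (bind a b) = C.act (FormalSum.map (fun y => C.act (b y)) a) := by
  rw [← join_map, C.act_join, FormalSum.map_map]

theorem act_add (a b : FormalSum R C) : C.act (a + b) = C.act a + C.act b := by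
  have h1 : FormalSum.join (single a + single b) = a + b := by
    simp only [FormalSum.join, bind_add, single_bind, id]
  have h2 := C.act_join (single a + single b)
  rw [h1, FormalSum.map_eq_bind, bind_add, single_bind, single_bind] at h2
  exact h2

theorem act_hom_aux (f : ∀ X : Type u, FormalSum R X → FormalSum R X)
    (hf : ∀ (X Y : Type u) (b : X → FormalSum R Y) (a), bind (f X a) b = f Y (bind a b))
    (a : FormalSum R C) : C.act (f C a) = C.act (f C (single (C.act a))) := by
  have h1 : FormalSum.join (f _ (single a)) = f C a := by
    rw [FormalSum.join, hf, single_bind, id]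
  have h2 := C.act_join (f _ (single a))
  rw [h1, map_eq_bind, hf, single_bind] at h2
  exact h2

theorem act_neg (a : FormalSum R C) : C.act (-a) = -C.act a :=
  act_hom_aux (fun _ a => -a) (fun _ _ b a => bind_neg a b) a

theorem act_sub (a b : FormalSum R C) : C.act (a - b) = C.act a - C.act b := by
  have h1 : FormalSum.join (single a - single b) = a - b := by
    rw [FormalSum.join, bind_sub, single_bind, single_bind, id, id]
  have h2 := C.act_join (single a - single b)
  rw [h1, FormalSum.map_sub, FormalSum.map_single, FormalSum.map_single] at h2
  exact h2

theorem act_surjective : Function.Surjective C.act := fun c => ⟨single c, C.act_single c⟩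

variable (C)

/-- The underlying additive group of a left contramodule. -/
noncomputable instance : AddCommGroup C :=
  Function.Surjective.addCommGroup C.act act_surjective rfl act_add act_neg act_sub
    (fun a n => act_hom_aux (fun _ a => n • a) (fun _ _ b a => bind_nsmul n a b) a)
    (fun a n => act_hom_aux (fun _ a => n • a) (fun _ _ b a => bind_zsmul n a b) a)

/-- The contraaction as an additive homomorphism. -/
noncomputable def actHom : FormalSum R C →+ C := AddMonoidHom.mk' C.act act_add

/-- For a (closed) subgroup `A` of `R`, the subgroup of `C` which is the image of
`A[[C]] ⊆ R[[C]]` under the contraaction map. -/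
def contraSpan (A : AddSubgroup R) : AddSubgroup C where
  carrier := {c | ∃ r : FormalSum R C, (∀ x, r.1 x ∈ A) ∧ C.act r = c}
  zero_mem' := ⟨0, fun _ => A.zero_mem, rfl⟩
  add_mem' := by
    rintro _ _ ⟨r, hr, rfl⟩ ⟨s, hs, rfl⟩
    exact ⟨r + s, fun x => A.add_mem (hr x) (hs x), act_add r s⟩
  neg_mem' := by
    rintro _ ⟨r, hr, rfl⟩
    exact ⟨-r, fun x => A.neg_mem (hr x), act_neg r⟩

end LeftContramodule

/-! ### Discrete right modules, contratensor product, flatness -/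

/-- A right `R`-module `N` is discrete if the annihilator of every element is open in `R`. -/
class IsDiscreteRightModule (R : Type*) [Ring R] [TopologicalSpace R] (N : Type*) [AddCommGroup N]
    [Module Rᵐᵒᵖ N] : Prop where
  isOpen_annihilator : ∀ b : N, IsOpen {r : R | MulOpposite.op r • b = 0}

section Contratensor

variable {R : Type u} [Ring R] [TopologicalSpace R] [IsContramoduleRing R]

theorem finite_support_smul {N : Type*} [AddCommGroup N] [Module Rᵐᵒᵖ N]
    [IsDiscreteRightModule R N] {X : Type*} (b : N) (r : FormalSum R X) :
    {x | MulOpposite.op (r.1 x) • b ≠ 0}.Finite := by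
  have h : {r : R | MulOpposite.op r • b = 0} ∈ 𝓝 (0 : R) :=
    (IsDiscreteRightModule.isOpen_annihilator b).mem_nhds (by simp)
  exact r.2 h

variable (N : Type u) [AddCommGroup N] [Module Rᵐᵒᵖ N] (C : LeftContramodule R)

/-- The image of the difference of the two maps `N ⊗ R[[C]] ⇉ N ⊗ C` (tensor products over `ℤ`),
`b ⊗ ∑ r_c c ↦ b ⊗ act (∑ r_c c)` and `b ⊗ ∑ r_c c ↦ ∑ (b r_c) ⊗ c`, where the last sum is finite
if `N` is discrete. -/
noncomputable def contratensorRelations : AddSubgroup (N ⊗[ℤ] C) :=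
  AddSubgroup.closure (Set.range fun p : N × FormalSum R C =>
    p.1 ⊗ₜ[ℤ] C.act p.2 - ∑ᶠ c : C, (MulOpposite.op (p.2.1 c) • p.1) ⊗ₜ[ℤ] c)

/-- The contratensor product `N ⊙ C` of a discrete right module `N` and a left contramodule `C`:
the cokernel of the difference of the two maps `N ⊗ R[[C]] ⇉ N ⊗ C`. -/
abbrev Contratensor : Type u := (N ⊗[ℤ] C) ⧸ contratensorRelations N C

variable {N} {N' : Type u} [AddCommGroup N'] [Module Rᵐᵒᵖ N']

/-- The homomorphism `f ⊙ C : N ⊙ C → N' ⊙ C` induced by a homomorphism of discrete right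
modules `f : N → N'`. -/
noncomputable def contratensorMap [IsDiscreteRightModule R N] (f : N →ₗ[Rᵐᵒᵖ] N') :
    Contratensor N C →+ Contratensor N' C :=
  QuotientAddGroup.map _ _ (TensorProduct.map f.toAddMonoidHom.toIntLinearMap
    LinearMap.id).toAddMonoidHom (by
      rw [contratensorRelations, AddSubgroup.closure_le]
      rintro _ ⟨⟨b, r⟩, rfl⟩
      refine AddSubgroup.subset_closure ⟨(f b, r), ?_⟩
      have hfin : (Function.support fun c : C =>
          (MulOpposite.op (r.1 c) • b) ⊗ₜ[ℤ] c).Finite :=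
        (finite_support_smul b r).subset fun c hc h => hc (by simp [h])
      simp only [map_sub, AddMonoidHom.map_finsum _ hfin, LinearMap.toAddMonoidHom_coe,
        TensorProduct.map_tmul]
      simp)

/-- A left contramodule `F` is flat if the functor `- ⊙ F` from discrete right modules to abelian
groups is exact: it takes short exact sequences to short exact sequences. -/
def LeftContramodule.IsFlat (F : LeftContramodule R) : Prop :=
  ∀ (L M N : Type u) [AddCommGroup L] [AddCommGroup M] [AddCommGroup N]
    [Module Rᵐᵒᵖ L] [Module Rᵐᵒᵖ M] [Module Rᵐᵒᵖ N]
    [IsDiscreteRightModule R L] [IsDiscreteRightModule R M] [IsDiscreteRightModule R N]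
    (f : L →ₗ[Rᵐᵒᵖ] M) (g : M →ₗ[Rᵐᵒᵖ] N),
    Function.Injective f → Function.Exact f g → Function.Surjective g →
      Function.Injective (contratensorMap F f) ∧
      Function.Exact (contratensorMap F f) (contratensorMap F g) ∧
      Function.Surjective (contratensorMap F g)

end Contratensor

/-! ### Ideals and reductions -/

section Ideals

variable {R : Type u} [Ring R] [TopologicalSpace R]

/-- An ideal `H` is topologically left T-nilpotent if for any sequence `a₁, a₂, a₃, …` of elements
of `H` the sequence of the products `a₁, a₁a₂, a₁a₂a₃, …` converges to zero. -/
def IsTopologicallyLeftTNilpotent (H : Ideal R) : Prop :=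
  ∀ a : ℕ → R, (∀ n, a n ∈ H) →
    Tendsto (fun n => ((List.range (n + 1)).map a).prod) atTop (𝓝 0)

/-- A closed ideal `H` is strongly closed if the quotient group `R ⧸ H` is complete in the quotient
topology and, for every set `X`, the map `R[[X]] → (R ⧸ H)[[X]]` induced by the projection is
surjective. -/
class IsStronglyClosed [IsTopologicalAddGroup R] (H : Ideal R) : Prop where
  isClosed : IsClosed (H : Set R)
  complete : @CompleteSpace (R ⧸ H) (IsTopologicalAddGroup.rightUniformSpace (R ⧸ H))
  exists_lift : ∀ (X : Type u) (s : FormalSum (R ⧸ H) X),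
    ∃ r : FormalSum R X, ∀ x, (Submodule.Quotient.mk (r.1 x) : R ⧸ H) = s.1 x

theorem continuous_idealQuotient_mk (H : Ideal R) [H.IsTwoSided] :
    Continuous (Ideal.Quotient.mk H) := H.continuous_mkQ

variable [IsContramoduleRing R] (H : Ideal R) [H.IsTwoSided] [IsStronglyClosed H]

/-- The quotient of `R` by a strongly closed two-sided ideal, with the quotient topology, is again
complete and separated with a base of open right ideals. -/
instance : IsContramoduleRing (R ⧸ H) := by
  have hq : IsOpenQuotientMap (Ideal.Quotient.mk H) := H.isOpenQuotientMap_mkQ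
  have hring : IsTopologicalRing (R ⧸ H) :=
    { Submodule.topologicalAddGroup_quotient H with
      continuous_mul := by
        rw [← (hq.prodMap hq).continuous_comp_iff]
        exact hq.continuous.comp continuous_mul }
  have hcl : IsClosed (H : Set R) := IsStronglyClosed.isClosed
  have hT3 : T3Space (R ⧸ H) := Submodule.t3_quotient_of_isClosed H
  have hlin : IsLinearTopology (R ⧸ H)ᵐᵒᵖ (R ⧸ H) := by
    rw [isLinearTopology_iff_hasBasis_open_submodule]
    refine ⟨fun U => ⟨fun hU => ?_, ?_⟩⟩
    · have h0 : Ideal.Quotient.mk H ⁻¹' U ∈ 𝓝 (0 : R) :=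
        hq.continuous.continuousAt.preimage_mem_nhds (by simpa using hU)
      obtain ⟨I, hI, hIU⟩ := exists_open_right_ideal h0
      let J : Submodule (R ⧸ H)ᵐᵒᵖ (R ⧸ H) :=
        { I.toAddSubgroup.map (Ideal.Quotient.mk H).toAddMonoidHom with
          smul_mem' := by
            rintro c _ ⟨x, hx, rfl⟩
            obtain ⟨r, hr⟩ := Ideal.Quotient.mk_surjective c.unop
            refine ⟨x * r, right_ideal_mul_mem I hx r, ?_⟩
            rw [← MulOpposite.op_unop c, ← hr]
            exact map_mul (Ideal.Quotient.mk H) x r }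
      refine ⟨J, hq.isOpenMap _ hI, ?_⟩
      rintro _ ⟨x, hx, rfl⟩
      exact hIU hx
    · rintro ⟨J, hJ, hJU⟩
      exact Filter.mem_of_superset (hJ.mem_nhds J.zero_mem) hJU
  exact { hring, hlin, (inferInstance : T2Space (R ⧸ H)) with
          complete := IsStronglyClosed.complete }

/-- The map `R[[X]] → (R ⧸ H)[[X]]` induced by the projection `R → R ⧸ H`. -/
noncomputable def coeffQuotient {X : Type*} (r : FormalSum R X) : FormalSum (R ⧸ H) X :=
  ⟨fun x => Ideal.Quotient.mk H (r.1 x), by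
    have h := (continuous_idealQuotient_mk H).tendsto 0
    rw [map_zero] at h
    exact h.comp r.2⟩

theorem coeffQuotient_surjective {X : Type u} :
    Function.Surjective (coeffQuotient H : FormalSum R X → FormalSum (R ⧸ H) X) := by
  intro s
  obtain ⟨r, hr⟩ := IsStronglyClosed.exists_lift X s
  exact ⟨r, FormalSum.ext hr⟩

open FormalSum

theorem coeffQuotient_single {X : Type*} (x : X) :
    coeffQuotient H (single x) = single x := by
  classical
  ext y
  change Ideal.Quotient.mk H ((single (R := R) x).1 y) = _
  by_cases h : y = x
  · subst h; simp [single]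
  · simp [single, Pi.single_eq_of_ne h]

theorem coeffQuotient_bind {X Y : Type*} (a : FormalSum R Y) (b : Y → FormalSum R X) :
    coeffQuotient H (bind a b) = bind (coeffQuotient H a) fun y => coeffQuotient H (b y) := by
  ext x
  change Ideal.Quotient.mk H (∑' y, a.1 y * (b y).1 x) =
    ∑' y, Ideal.Quotient.mk H (a.1 y) * Ideal.Quotient.mk H ((b y).1 x)
  rw [(summable_bind a fun y => (b y).1 x).map_tsum (Ideal.Quotient.mk H)
    (continuous_idealQuotient_mk H)]
  simp

theorem coeffQuotient_map {X Y : Type*} (f : X → Y) (a : FormalSum R X) :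
    coeffQuotient H (FormalSum.map f a) = FormalSum.map f (coeffQuotient H a) := by
  simp only [FormalSum.map_eq_bind, coeffQuotient_bind, coeffQuotient_single]

theorem map_surjective {X Y : Type*} {f : X → Y} (hf : Function.Surjective f) :
    Function.Surjective (FormalSum.map f : FormalSum R X → FormalSum R Y) := fun a =>
  ⟨FormalSum.map (Function.surjInv hf) a, by
    rw [FormalSum.map_map]; simp only [Function.surjInv_eq hf]; exact FormalSum.map_id a⟩

variable (C : LeftContramodule R)

namespace LeftContramodule

/-- The subgroup `H ⋌ C` of `C`: the image of `H[[C]]` under the contraaction map. -/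
def idealContraSpan : AddSubgroup C := C.contraSpan H.toAddSubgroup

/-- The underlying group `C ⧸ (H ⋌ C)` of the reduction of `C` modulo `H`. -/
abbrev ReductionCarrier : Type u := C ⧸ C.idealContraSpan H

/-- The projection `C → C ⧸ (H ⋌ C)`. -/
noncomputable def toReduction : C →+ C.ReductionCarrier H := QuotientAddGroup.mk' _

theorem toReduction_surjective : Function.Surjective (C.toReduction H) :=
  QuotientAddGroup.mk'_surjective _

theorem act_bind_mem_left {Y : Type*} (a : FormalSum R Y) (b : Y → FormalSum R C)
    (ha : ∀ y, a.1 y ∈ H) : C.act (bind a b) ∈ C.idealContraSpan H :=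
  ⟨bind a b, fun _ => tsum_mem_of_isClosed (H := H.toAddSubgroup) IsStronglyClosed.isClosed
    fun y => H.mul_mem_right _ (ha y), rfl⟩

theorem act_bind_mem_right {Y : Type*} (a : FormalSum R Y) (b : Y → FormalSum R C)
    (hb : ∀ y x, (b y).1 x ∈ H) : C.act (bind a b) ∈ C.idealContraSpan H :=
  ⟨bind a b, fun x => tsum_mem_of_isClosed (H := H.toAddSubgroup) IsStronglyClosed.isClosed
    fun y => H.mul_mem_left _ (hb y x), rfl⟩

/-- The map `R[[C]] → (R ⧸ H)[[C ⧸ (H ⋌ C)]]` induced by the two projections. -/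
noncomputable def pushSum (r : FormalSum R C) : FormalSum (R ⧸ H) (C.ReductionCarrier H) :=
  coeffQuotient H (FormalSum.map (C.toReduction H) r)

theorem pushSum_surjective : Function.Surjective (C.pushSum H) :=
  (coeffQuotient_surjective H).comp (map_surjective (C.toReduction_surjective H))

/-- The class of `act r` modulo `H ⋌ C` depends only on the image of `r` in
`(R ⧸ H)[[C ⧸ (H ⋌ C)]]`. -/
theorem toReduction_act_eq {r r' : FormalSum R C} (h : C.pushSum H r = C.pushSum H r') :
    C.toReduction H (C.act r) = C.toReduction H (C.act r') := by
  let q := C.toReduction H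
  let σ : C.ReductionCarrier H → C := Function.surjInv (C.toReduction_surjective H)
  have hσ : ∀ x, q (σ x) = x := Function.surjInv_eq (C.toReduction_surjective H)
  let w := r - r'
  have hw : ∀ x, (FormalSum.map q w).1 x ∈ H := by
    intro x
    have hx := congrFun (congrArg Subtype.val h) x
    change Ideal.Quotient.mk H ((FormalSum.map q r).1 x) = Ideal.Quotient.mk H ((FormalSum.map q r').1 x) at hx
    rw [FormalSum.map_sub]
    exact Ideal.Quotient.eq.1 hx
  have hdiff : ∀ x : C, ∃ v : FormalSum R C, (∀ y, v.1 y ∈ H) ∧ C.act v = x - σ (q x) := by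
    intro x
    have hx : q (x - σ (q x)) = 0 := by rw [_root_.map_sub, hσ, sub_self]
    exact (QuotientAddGroup.eq_zero_iff _).1 hx
  choose v hv hv' using hdiff
  have h1 : C.act (bind w v) = C.act w - C.act (FormalSum.map (fun x => σ (q x)) w) := by
    have hs : ∀ x, C.act (v x) = C.act (single x - single (σ (q x))) := fun x => by
      rw [hv', act_sub, C.act_single, C.act_single]
    rw [act_bind]
    simp only [hs]
    rw [← act_bind, bind_sub_right, act_sub, bind_single, FormalSum.map_eq_bind]
  have h2 : C.act (bind w v) ∈ C.idealContraSpan H := C.act_bind_mem_right H w v hv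
  have h3 : C.act (FormalSum.map (fun x => σ (q x)) w) ∈ C.idealContraSpan H := by
    rw [← FormalSum.map_map q σ, FormalSum.map_eq_bind σ]
    exact C.act_bind_mem_left H _ _ hw
  have h4 : C.act w ∈ C.idealContraSpan H := by
    have := add_mem h2 h3
    rwa [h1, sub_add_cancel] at this
  have h5 : q (C.act w) = 0 := (QuotientAddGroup.eq_zero_iff _).2 h4
  rw [act_sub, _root_.map_sub] at h5
  exact sub_eq_zero.1 h5

/-- The contraaction on `C ⧸ (H ⋌ C)`: an element of `(R ⧸ H)[[C ⧸ (H ⋌ C)]]` is lifted to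
`R[[C]]`, and the contraaction of `C` is applied. -/
noncomputable def reductionAct (s : FormalSum (R ⧸ H) (C.ReductionCarrier H)) :
    C.ReductionCarrier H :=
  C.toReduction H (C.act (Function.surjInv (C.pushSum_surjective H) s))

theorem reductionAct_pushSum (r : FormalSum R C) :
    C.reductionAct H (C.pushSum H r) = C.toReduction H (C.act r) :=
  C.toReduction_act_eq H (Function.surjInv_eq (C.pushSum_surjective H) _)

theorem pushSum_bind {Y : Type*} (a : FormalSum R Y) (b : Y → FormalSum R C) :
    C.pushSum H (bind a b) = bind (coeffQuotient H a) fun y => C.pushSum H (b y) := by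
  simp only [pushSum, FormalSum.map_bind, coeffQuotient_bind]

/-- The reduction `C ⧸ (H ⋌ C)` of a left `R`-contramodule `C` modulo a strongly closed two-sided
ideal `H`, as a left `R ⧸ H`-contramodule. -/
noncomputable def reduction : LeftContramodule (R ⧸ H) where
  carrier := C.ReductionCarrier H
  act := C.reductionAct H
  act_single c := by
    obtain ⟨x, rfl⟩ := C.toReduction_surjective H c
    have h : C.pushSum H (single x) = single (C.toReduction H x) := by
      rw [pushSum, FormalSum.map_single, coeffQuotient_single]
    rw [← h, reductionAct_pushSum, C.act_single]
  act_join s := by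
    obtain ⟨t', rfl⟩ := coeffQuotient_surjective H s
    obtain ⟨t, rfl⟩ := map_surjective (C.pushSum_surjective H) t'
    have h1 : FormalSum.join (coeffQuotient H (FormalSum.map (C.pushSum H) t)) =
        C.pushSum H (FormalSum.join t) := by
      rw [coeffQuotient_map, join_map, FormalSum.join, pushSum_bind]
      rfl
    have h2 : FormalSum.map (C.reductionAct H) (coeffQuotient H (FormalSum.map (C.pushSum H) t)) =
        C.pushSum H (FormalSum.map C.act t) := by
      rw [pushSum, ← coeffQuotient_map, FormalSum.map_map, FormalSum.map_map]
      simp only [reductionAct_pushSum]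
    rw [h1, h2, reductionAct_pushSum, reductionAct_pushSum, C.act_join]

end LeftContramodule

end Ideals

end ContramoduleTheory

/-! Write `π` for the contraaction `R[[F]] → F`. A contramodule is projective if and only if `π` has
a section which is a morphism (`projective_iff_exists_section`). Such a section for `F` takes `H ⋌
F` to combinations with coefficients in `H`, modulo the kernel of the projection, so it descends to
the reduction; this is the easy direction, and it needs neither flatness nor T-nilpotency.

Conversely, strong closedness lifts a section for the reduction to a map of sets `α : F → R[[F]]`
with `π α = id` exactly, but compatible with the contraactions only modulo `H`
(`exists_lift_of_projective_reduction`). Extend `α` to the endomorphism `r ↦ bind r α` of `R[[F]]`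
and iterate it. The crucial claim is that the iterates tend to zero on `ker π`
(`bind_iterate_convergesTo_zero`). It is checked modulo each open right ideal `I`, that is, after
passing from `R[[F]]` to the finite combinations with coefficients in the discrete module `R ⧸ I`.
If the coefficients lie in a module annihilated by `H`, then `α` acts through the contratensor
product, so one application kills everything of zero class. Flatness keeps the class zero when the
coefficients are restricted to a submodule. Hence, for submodules `L ⊆ L'` with `L'H ⊆ L`, one
application of `α` moves the coefficients from `L'` into `L`; by Zorn's lemma and T-nilpotency every
element of zero class is killed by finitely many applications.

Since `α x - x` lies in `ker π`, the iterates at `x` form a Cauchy sequence. The limit `e` kills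
`ker π`, so it is a morphism `F → R[[F]]`, and it is congruent to `α` modulo `H`. The composite `θ =
π e` is idempotent, and it is surjective by Nakayama's lemma, because it is the identity modulo `H ⋌
F`. Hence `θ = id`, and `e` is the required section. -/

namespace ContramoduleTheory

open Filter Topology CategoryTheory

namespace LeftContramodule

open FormalSum

variable {R : Type u} [Ring R] [TopologicalSpace R] [IsContramoduleRing R]

/-! ### Free contramodules, epimorphisms and projectivity -/

/-- The free left contramodule `R[[X]]`. -/
noncomputable def free (R : Type u) [Ring R] [TopologicalSpace R] [IsContramoduleRing R]
    (X : Type u) : LeftContramodule R where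
  carrier := FormalSum R X
  act := FormalSum.join
  act_single c := single_bind c id
  act_join r := by
    rw [join_map]
    exact bind_assoc r id id

/-- The contraaction as a morphism from the free contramodule. -/
noncomputable def actFromFree (C : LeftContramodule R) : free R C ⟶ C where
  toFun := C.act
  map_act := C.act_join

theorem toFun_comp {C D E : LeftContramodule R} (f : C ⟶ D) (g : D ⟶ E) (c : C) :
    Hom.toFun (f ≫ g) c = Hom.toFun g (Hom.toFun f c) := rfl

theorem hom_ext {C D : LeftContramodule R} {f g : C ⟶ D}
    (h : ∀ c, Hom.toFun f c = Hom.toFun g c) : f = g :=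
  Hom.ext (funext h)

theorem epi_of_surjective {C D : LeftContramodule R} (f : C ⟶ D)
    (hf : Function.Surjective (Hom.toFun f)) : Epi f where
  left_cancellation g h hgh := hom_ext fun d => by
    obtain ⟨c, rfl⟩ := hf d
    exact congrFun (congrArg Hom.toFun hgh) c

theorem Hom.map_add {C D : LeftContramodule R} (f : Hom C D) (a b : C) :
    f.toFun (a + b) = f.toFun a + f.toFun b := by
  change f.toFun (C.act _) = D.act _
  rw [f.map_act, map_eq_bind, bind_add, single_bind, single_bind]

/-- A morphism of contramodules as an additive homomorphism. -/
noncomputable def Hom.toAddMonoidHom {C D : LeftContramodule R} (f : Hom C D) : C →+ D :=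
  AddMonoidHom.mk' f.toFun f.map_add

/-! ### Cokernels and the surjectivity of epimorphisms. -/

section Cokernel

variable {C D : LeftContramodule R} (f : Hom C D)

/-- The projection of `D` onto the cokernel of `f : C → D`. -/
noncomputable def toCokernel : D →+ D ⧸ f.toAddMonoidHom.range := QuotientAddGroup.mk' _

theorem toCokernel_surjective : Function.Surjective (toCokernel f) :=
  QuotientAddGroup.mk'_surjective _

/-- This makes the contraaction well defined on the cokernel of abelian groups. Each `x` splits as
`σ (q x)` plus a value of `f`. Applied to all formal variables of `w = r - r'`, the first summands
cancel because `w` has zero image, and the second ones contribute a value of `f`. -/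
theorem toCokernel_act_eq {r r' : FormalSum R D}
    (h : FormalSum.map (toCokernel f) r = FormalSum.map (toCokernel f) r') :
    toCokernel f (D.act r) = toCokernel f (D.act r') := by
  let q := toCokernel f
  let σ := Function.surjInv (toCokernel_surjective f)
  have hσ : ∀ x, q (σ x) = x := Function.surjInv_eq (toCokernel_surjective f)
  let w := r - r'
  have hw : FormalSum.map q w = 0 := by
    rw [FormalSum.map_sub]
    exact sub_eq_zero.2 h
  have hdiff : ∀ x : D, ∃ c : C, f.toFun c = x - σ (q x) := fun x => by
    have hx : q (x - σ (q x)) = 0 := by rw [_root_.map_sub, hσ, sub_self]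
    exact (QuotientAddGroup.eq_zero_iff _).1 hx
  choose c hc using hdiff
  have h1 : D.act (FormalSum.map (fun x => f.toFun (c x)) w) =
      D.act w - D.act (FormalSum.map (fun x => σ (q x)) w) := by
    have hs : ∀ x, f.toFun (c x) = D.act (single x - single (σ (q x))) := fun x => by
      rw [hc, act_sub, D.act_single, D.act_single]
    simp only [hs]
    rw [← act_bind, bind_sub_right, act_sub, bind_single, ← FormalSum.map_eq_bind]
  have h2 : D.act (FormalSum.map (fun x => σ (q x)) w) = 0 := by
    rw [← FormalSum.map_map q σ, hw, map_eq_bind, bind_zero]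
    rfl
  rw [h2, sub_zero, ← FormalSum.map_map c f.toFun, ← f.map_act] at h1
  have h3 : q (D.act w) = 0 := (QuotientAddGroup.eq_zero_iff _).2 ⟨_, h1⟩
  rw [act_sub, _root_.map_sub] at h3
  exact sub_eq_zero.1 h3

/-- The contraaction on the cokernel of a morphism. -/
noncomputable def cokernelAct (s : FormalSum R (D ⧸ f.toAddMonoidHom.range)) :
    D ⧸ f.toAddMonoidHom.range :=
  toCokernel f (D.act (Function.surjInv (map_surjective (toCokernel_surjective f)) s))

theorem cokernelAct_map (r : FormalSum R D) :
    cokernelAct f (FormalSum.map (toCokernel f) r) = toCokernel f (D.act r) :=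
  toCokernel_act_eq f (Function.surjInv_eq (map_surjective (toCokernel_surjective f)) _)

/-- The cokernel of a morphism of contramodules. -/
noncomputable def cokernel : LeftContramodule R where
  carrier := D ⧸ f.toAddMonoidHom.range
  act := cokernelAct f
  act_single c := by
    obtain ⟨x, rfl⟩ := toCokernel_surjective f c
    rw [← FormalSum.map_single, cokernelAct_map, D.act_single]
  act_join s := by
    obtain ⟨t, rfl⟩ := map_surjective (map_surjective (toCokernel_surjective f)) s
    have h : FormalSum.join (FormalSum.map (FormalSum.map (toCokernel f)) t) =
        FormalSum.map (toCokernel f) (FormalSum.join t) := by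
      rw [join_map, FormalSum.join, FormalSum.map_bind]
      rfl
    rw [h, FormalSum.map_map]
    simp only [cokernelAct_map]
    rw [D.act_join, ← FormalSum.map_map D.act, cokernelAct_map]

end Cokernel

/-- The projection onto the cokernel and the zero morphism agree after composition with `f`. -/
theorem surjective_of_epi {C D : LeftContramodule R} (f : C ⟶ D) [Epi f] :
    Function.Surjective (Hom.toFun f) := by
  let p : D ⟶ cokernel f := ⟨toCokernel f, fun r => (cokernelAct_map f r).symm⟩
  have hz : ∀ r : FormalSum R D,
      toCokernel f 0 = cokernelAct f (FormalSum.map (fun _ => toCokernel f 0) r) := fun r => by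
    rw [← FormalSum.map_map (fun _ => (0 : D)), cokernelAct_map, map_eq_bind]
    have h1 : D.act (bind r fun _ : D => single (0 : D)) =
        D.act (bind r fun _ : D => (0 : FormalSum R D)) := by
      rw [act_bind, act_bind]
      simp only [D.act_single]
      rfl
    have h2 : bind r (fun _ : D => (0 : FormalSum R D)) = 0 := by
      have := bind_sub_right r (fun _ => (0 : FormalSum R D)) (fun _ => (0 : FormalSum R D))
      simpa using this
    rw [h1, h2]
    rfl
  let z : D ⟶ cokernel f := ⟨fun _ => toCokernel f 0, hz⟩
  have hpz : p = z := by
    rw [← cancel_epi f]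
    refine hom_ext fun c => ?_
    change toCokernel f (Hom.toFun f c) = toCokernel f 0
    rw [map_zero]
    exact (QuotientAddGroup.eq_zero_iff _).2 ⟨c, rfl⟩
  intro d
  have hd : toCokernel f d = toCokernel f 0 := congrFun (congrArg Hom.toFun hpz) d
  rw [map_zero] at hd
  exact (QuotientAddGroup.eq_zero_iff _).1 hd

/-- A contramodule is projective if and only if its contraaction has a section in the category of
contramodules. -/
theorem projective_iff_exists_section (C : LeftContramodule R) :
    Projective C ↔ ∃ e : C → FormalSum R C,
      (∀ r : FormalSum R C, e (C.act r) = bind r e) ∧ ∀ c, C.act (e c) = c := by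
  constructor
  · intro hC
    have := epi_of_surjective (actFromFree C) act_surjective
    let s := Projective.factorThru (𝟙 C) (actFromFree C)
    have hs : s ≫ actFromFree C = 𝟙 C := Projective.factorThru_comp _ _
    refine ⟨Hom.toFun s, fun r => ?_, fun c => congrFun (congrArg Hom.toFun hs) c⟩
    exact (Hom.map_act s r).trans (join_map r _)
  · rintro ⟨e, he, hec⟩
    refine ⟨fun {E X} f g hg => ?_⟩
    -- A mere map of sets is enough: it is used only on the basis of the free contramodule `R[[C]]`,
    -- and the resulting morphism is composed with `e`.
    let σ := Function.surjInv (surjective_of_epi g)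
    have hσ : ∀ x, Hom.toFun g (σ x) = x := Function.surjInv_eq (surjective_of_epi g)
    refine ⟨⟨fun c => E.act (FormalSum.map (fun d => σ (Hom.toFun f d)) (e c)), fun r => ?_⟩,
      hom_ext fun c => ?_⟩
    · rw [he, FormalSum.map_bind, act_bind]
    · rw [toFun_comp]
      change Hom.toFun g (E.act _) = _
      rw [Hom.map_act g, FormalSum.map_map]
      simp only [hσ]
      rw [← Hom.map_act f, hec]

/-- The reduction of a projective contramodule is projective. -/
theorem projective_reduction (H : Ideal R) [H.IsTwoSided] [IsStronglyClosed H]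
    (F : LeftContramodule R) (hF : Projective F) : Projective (F.reduction H) := by
  obtain ⟨e, he, hec⟩ := (projective_iff_exists_section F).1 hF
  rw [projective_iff_exists_section]
  let q := F.toReduction H
  have hq := F.toReduction_surjective H
  have hadd : ∀ x y, e (x - y) = e x - e y := fun x y => by
    change e (F.act _) = _
    rw [he, bind_sub, single_bind, single_bind]
  -- An element of `H ⋌ F` is `act r` with `r` over `H`, and `e (act r) = bind r e` vanishes when
  -- the coefficients are reduced modulo `H`.
  have hzero : ∀ x, q x = 0 → F.pushSum H (e x) = 0 := fun x hx => by
    obtain ⟨r, hr, rfl⟩ := (QuotientAddGroup.eq_zero_iff _).1 hx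
    rw [he, pushSum_bind]
    have h0 : coeffQuotient H r = 0 := FormalSum.ext fun x => Ideal.Quotient.eq_zero_iff_mem.2 (hr x)
    rw [h0, bind_zero]
  have hcongr : ∀ x y, q x = q y → F.pushSum H (e x) = F.pushSum H (e y) := fun x y h => by
    have h1 := hzero (x - y) (by rw [_root_.map_sub, h, sub_self])
    have h2 : ∀ a b : FormalSum R F, F.pushSum H (a - b) = F.pushSum H a - F.pushSum H b :=
      fun a b => by
        rw [pushSum, FormalSum.map_sub]
        exact FormalSum.ext fun x => _root_.map_sub (Ideal.Quotient.mk H) _ _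
    rw [hadd, h2] at h1
    exact sub_eq_zero.1 h1
  have hσ : ∀ x, q (Function.surjInv hq x) = x := Function.surjInv_eq hq
  let e' : F.reduction H → FormalSum (R ⧸ H) (F.reduction H) :=
    fun c => F.pushSum H (e (Function.surjInv hq c))
  have he' : ∀ x, e' (q x) = F.pushSum H (e x) := fun x => hcongr _ _ (hσ _)
  refine ⟨e', fun r => ?_, fun c => ?_⟩
  · obtain ⟨r, rfl⟩ := F.pushSum_surjective H r
    change e' (F.reductionAct H _) = _
    rw [reductionAct_pushSum, he', he, pushSum_bind, pushSum, coeffQuotient_map]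
    exact ((bind_map (coeffQuotient H r) q e').trans (congrArg _ (funext he'))).symm
  · obtain ⟨x, rfl⟩ := hq c
    rw [he']
    change F.reductionAct H _ = _
    rw [reductionAct_pushSum, hec]

end LeftContramodule

end ContramoduleTheory

namespace ContramoduleTheory

open Filter Topology CategoryTheory

namespace FormalSum

variable {R : Type*} [Ring R] [TopologicalSpace R] [IsContramoduleRing R] {X Y : Type*}

/-! ### The topology of uniform convergence of the coefficients -/

/-- The formal linear combinations with coefficients in a subgroup `A` of `R`. -/
def coeffsIn (A : AddSubgroup R) (X : Type*) : AddSubgroup (FormalSum R X) where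
  carrier := {r | ∀ x, r.1 x ∈ A}
  zero_mem' _ := A.zero_mem
  add_mem' ha hb x := A.add_mem (ha x) (hb x)
  neg_mem' ha x := A.neg_mem (ha x)

theorem isClosed_right_ideal {I : Submodule Rᵐᵒᵖ R} (hI : IsOpen (I : Set R)) :
    IsClosed (I.toAddSubgroup : Set R) :=
  AddSubgroup.isClosed_of_isOpen I.toAddSubgroup hI

theorem bind_mem_of_mul_mem {A : AddSubgroup R} (hA : IsClosed (A : Set R)) {r : FormalSum R Y}
    {b : Y → FormalSum R X} (h : ∀ y x, r.1 y * (b y).1 x ∈ A) : bind r b ∈ coeffsIn A X :=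
  fun x => tsum_mem_of_isClosed hA fun y => h y x

theorem bind_mem_of_left {I : Submodule Rᵐᵒᵖ R} (hI : IsOpen (I : Set R)) {r : FormalSum R Y}
    (hr : r ∈ coeffsIn I.toAddSubgroup Y) (b : Y → FormalSum R X) :
    bind r b ∈ coeffsIn I.toAddSubgroup X :=
  bind_mem_of_mul_mem (isClosed_right_ideal hI) fun y _ => right_ideal_mul_mem I (hr y) _

theorem eq_of_forall_sub_mem {r s : FormalSum R X}
    (h : ∀ I : Submodule Rᵐᵒᵖ R, IsOpen (I : Set R) → r - s ∈ coeffsIn I.toAddSubgroup X) :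
    r = s := by
  ext x
  by_contra hne
  have h0 : r.1 x - s.1 x ≠ 0 := sub_ne_zero.2 hne
  obtain ⟨I, hI, hIU⟩ := exists_open_right_ideal (isOpen_compl_singleton.mem_nhds h0.symm)
  exact hIU (h I hI x) rfl

theorem mem_coeffsIn_of_isClosed {A : AddSubgroup R} (hA : IsClosed (A : Set R))
    {r : FormalSum R X}
    (h : ∀ I : Submodule Rᵐᵒᵖ R, IsOpen (I : Set R) →
      ∃ s ∈ coeffsIn A X, r - s ∈ coeffsIn I.toAddSubgroup X) : r ∈ coeffsIn A X := by
  intro x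
  rw [← SetLike.mem_coe, ← hA.closure_eq, mem_closure_iff_nhds_zero]
  intro U hU
  have hU' : {a : R | -a ∈ U} ∈ 𝓝 (0 : R) :=
    continuous_neg.continuousAt.preimage_mem_nhds (by simpa using hU)
  obtain ⟨I, hI, hIU⟩ := exists_open_right_ideal hU'
  obtain ⟨s, hs, hrs⟩ := h I hI
  refine ⟨s.1 x, hs x, ?_⟩
  have : -(r.1 x - s.1 x) ∈ U := hIU (hrs x)
  rwa [neg_sub] at this

/-- Convergence of a sequence of formal linear combinations, uniformly in the coefficients. -/
def ConvergesTo (s : ℕ → FormalSum R X) (l : FormalSum R X) : Prop :=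
  ∀ I : Submodule Rᵐᵒᵖ R, IsOpen (I : Set R) →
    ∃ N, ∀ n, N ≤ n → s n - l ∈ coeffsIn I.toAddSubgroup X

theorem ConvergesTo.unique {s : ℕ → FormalSum R X} {l l' : FormalSum R X} (h : ConvergesTo s l)
    (h' : ConvergesTo s l') : l = l' := by
  refine eq_of_forall_sub_mem fun I hI => ?_
  obtain ⟨N, hN⟩ := h I hI
  obtain ⟨N', hN'⟩ := h' I hI
  have := sub_mem (hN' (max N N') (le_max_right _ _)) (hN (max N N') (le_max_left _ _))
  rwa [sub_sub_sub_cancel_left] at this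

theorem ConvergesTo.sub {s t : ℕ → FormalSum R X} {l m : FormalSum R X} (hs : ConvergesTo s l)
    (ht : ConvergesTo t m) : ConvergesTo (fun n => s n - t n) (l - m) := fun I hI => by
  obtain ⟨N, hN⟩ := hs I hI
  obtain ⟨N', hN'⟩ := ht I hI
  refine ⟨max N N', fun n hn => ?_⟩
  rw [sub_sub_sub_comm]
  exact sub_mem (hN n ((le_max_left _ _).trans hn)) (hN' n ((le_max_right _ _).trans hn))

theorem convergesTo_const (l : FormalSum R X) : ConvergesTo (fun _ => l) l := fun I _ =>
  ⟨0, fun n _ => by rw [sub_self]; exact zero_mem _⟩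

theorem ConvergesTo.bind_left {s : ℕ → FormalSum R Y} {l : FormalSum R Y} (h : ConvergesTo s l)
    (b : Y → FormalSum R X) : ConvergesTo (fun n => bind (s n) b) (bind l b) := fun I hI => by
  obtain ⟨N, hN⟩ := h I hI
  refine ⟨N, fun n hn => ?_⟩
  rw [← bind_sub]
  exact bind_mem_of_left hI (hN n hn) b

/-- Convergence for each `y` separately, with no uniformity in `y`, is enough: all but finitely many
`k y` lie in the right ideal `I` already, and continuity of multiplication by `k y` handles the
others. -/
theorem ConvergesTo.bind_right (k : FormalSum R Y) {s : ℕ → Y → FormalSum R X}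
    {l : Y → FormalSum R X} (h : ∀ y, ConvergesTo (fun n => s n y) (l y)) :
    ConvergesTo (fun n => bind k (s n)) (bind k l) := fun I hI => by
  have hJ : ∀ y, ∃ N, ∀ n, N ≤ n → ∀ x, k.1 y * (s n y - l y).1 x ∈ I := fun y => by
    obtain ⟨J, hJ, hJI⟩ := exists_mul_mem I hI (k.1 y)
    obtain ⟨N, hN⟩ := h y J hJ
    exact ⟨N, fun n hn x => hJI _ (hN n hn x)⟩
  choose N hN using hJ
  have hfin := tendsto_zero_iff.1 k.2 I hI
  refine ⟨hfin.toFinset.sup N, fun n hn => ?_⟩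
  rw [← bind_sub_right]
  refine bind_mem_of_mul_mem (isClosed_right_ideal hI) fun y x => ?_
  by_cases hy : k.1 y ∈ I
  · exact right_ideal_mul_mem I hy _
  · exact hN y n ((Finset.le_sup (f := N) (hfin.mem_toFinset.2 hy)).trans hn) x

/-- Completeness of `R` gives a limit for each coefficient. Open right ideals are closed, so the
Cauchy estimates pass to the limit, and they show that the limit coefficients again converge to
zero. -/
theorem exists_convergesTo {s : ℕ → FormalSum R X}
    (h : ∀ I : Submodule Rᵐᵒᵖ R, IsOpen (I : Set R) →
      ∃ N, ∀ n, N ≤ n → s n - s N ∈ coeffsIn I.toAddSubgroup X) : ∃ l, ConvergesTo s l := by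
  have hlim : ∀ x, ∃ l : R, Tendsto (fun n => (s n).1 x) atTop (𝓝 l) := fun x => by
    have h0 : Tendsto (fun n => (s (n + 1)).1 x - (s n).1 x) cofinite (𝓝 0) := by
      rw [tendsto_zero_iff]
      intro I hI
      obtain ⟨N, hN⟩ := h I hI
      refine (Set.finite_lt_nat N).subset fun n hn => ?_
      by_contra hlt
      have hle : N ≤ n := not_lt.1 hlt
      have := sub_mem (hN (n + 1) (hle.trans n.le_succ)) (hN n hle)
      rw [sub_sub_sub_cancel_right] at this
      exact hn (this x)
    have h1 := (summable_of_tendsto_zero h0).hasSum.tendsto_sum_nat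
    simp only [Finset.sum_range_sub (fun n => (s n).1 x)] at h1
    exact ⟨_, by simpa using h1.add_const ((s 0).1 x)⟩
  choose l hl using hlim
  have hmem : ∀ I : Submodule Rᵐᵒᵖ R, IsOpen (I : Set R) →
      ∃ N, ∀ n, N ≤ n → ∀ x, (s n).1 x - l x ∈ I := fun I hI => by
    obtain ⟨N, hN⟩ := h I hI
    refine ⟨N, fun n hn x => ?_⟩
    refine (isClosed_right_ideal hI).mem_of_tendsto ((hl x).const_sub ((s n).1 x)) ?_
    filter_upwards [eventually_ge_atTop N] with m hm
    have := sub_mem (hN n hn) (hN m hm)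
    rw [sub_sub_sub_cancel_right] at this
    exact this x
  refine ⟨⟨l, tendsto_zero_iff.2 fun I hI => ?_⟩, fun I hI => hmem I hI⟩
  obtain ⟨N, hN⟩ := hmem I hI
  refine (tendsto_zero_iff.1 (s N).2 I hI).subset fun x hx hsx => hx ?_
  have := I.sub_mem hsx (hN N le_rfl x)
  rwa [sub_sub_cancel] at this

/-! ### Iteration of substitutions -/

/-- The iterates of a substitution `α : X → R[[X]]`. -/
noncomputable def iterate (α : X → FormalSum R X) : ℕ → X → FormalSum R X
  | 0 => single
  | n + 1 => fun x => bind (iterate α n x) α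

theorem bind_iterate_zero (α : X → FormalSum R X) (r : FormalSum R X) :
    bind r (iterate α 0) = r := bind_single r

theorem bind_iterate_succ (α : X → FormalSum R X) (r : FormalSum R X) (n : ℕ) :
    bind r (iterate α (n + 1)) = bind (bind r (iterate α n)) α :=
  (bind_assoc r _ _).symm

theorem bind_bind_iterate (α : X → FormalSum R X) (r : FormalSum R X) (n : ℕ) :
    bind (bind r α) (iterate α n) = bind r (iterate α (n + 1)) := by
  induction n with
  | zero => rw [bind_iterate_succ, bind_iterate_zero, bind_iterate_zero]
  | succ n ih => rw [bind_iterate_succ, ih, ← bind_iterate_succ]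

theorem bind_iterate_mem_of_le (α : X → FormalSum R X) {I : Submodule Rᵐᵒᵖ R}
    (hI : IsOpen (I : Set R)) {r : FormalSum R X} {m n : ℕ} (hmn : m ≤ n)
    (h : bind r (iterate α m) ∈ coeffsIn I.toAddSubgroup X) :
    bind r (iterate α n) ∈ coeffsIn I.toAddSubgroup X := by
  induction n, hmn using Nat.le_induction with
  | base => exact h
  | succ n _ ih =>
    rw [bind_iterate_succ]
    exact bind_mem_of_left hI ih α

end FormalSum

/-! ### Topologically T-nilpotent ideals -/

section TNilpotent

open FormalSum

variable {R : Type u} [Ring R] [TopologicalSpace R] [IsContramoduleRing R]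

/-- Induction on the elements of the discrete right module `R ⧸ I`. -/
theorem IsTopologicallyLeftTNilpotent.induction {H : Ideal R}
    (hH : IsTopologicallyLeftTNilpotent H) {I : Submodule Rᵐᵒᵖ R} (hI : IsOpen (I : Set R))
    {P : R → Prop} (mem : ∀ r ∈ I, P r) (step : ∀ r, (∀ h ∈ H, P (r * h)) → P r) (r : R) : P r := by
  by_contra hr
  -- A counterexample `r` yields, by dependent choice, counterexamples `r h₁ ⋯ hₙ` for all `n`;
  -- T-nilpotency puts one of them into `I`.
  have hnext : ∀ r : {r // ¬P r}, ∃ h ∈ H, ¬P (r.1 * h) := fun r => by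
    by_contra hcon
    push Not at hcon
    exact r.2 (step _ hcon)
  choose g hgH hg using hnext
  let seq : ℕ → {r // ¬P r} := fun n => Nat.rec ⟨r, hr⟩ (fun _ s => ⟨s.1 * g s, hg s⟩) n
  have hprod : ∀ n, r * ((List.range n).map fun i => g (seq i)).prod = (seq n).1 := by
    intro n
    induction n with
    | zero => simp [seq]
    | succ n ih => rw [List.range_succ, List.map_append, List.prod_append, ← mul_assoc, ih]; simp [seq]
  obtain ⟨J, hJ, hJI⟩ := exists_mul_mem I hI r
  obtain ⟨n, hn⟩ := ((hH _ fun i => hgH (seq i)).eventually_mem (hJ.mem_nhds J.zero_mem)).exists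
  have := hJI _ hn
  rw [hprod] at this
  exact (seq (n + 1)).2 (mem _ this)

/-- The coefficients of the iterates are sums of products of elements of `H` along paths in `X`.
Modulo an open right ideal only finitely many branches matter at each step, so this is a König-type
argument, carried out by T-nilpotent induction. -/
theorem iterate_convergesTo_zero {H : Ideal R} (hH : IsTopologicallyLeftTNilpotent H) {X : Type*}
    {w : X → FormalSum R X} (hw : ∀ x, w x ∈ coeffsIn H.toAddSubgroup X) (x : X) :
    ConvergesTo (fun n => iterate w n x) 0 := by
  intro I hI
  simp only [sub_zero]
  -- The left factor `r` records the product along the path so far; without it the induction could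
  -- not proceed.
  have key : ∀ r : R, ∀ x, ∃ N, ∀ n, N ≤ n → ∀ y, r * (iterate w n x).1 y ∈ I := by
    refine fun r => hH.induction hI (P := fun r => ∀ x, ∃ N, ∀ n, N ≤ n → ∀ y,
      r * (iterate w n x).1 y ∈ I) (fun r hr x => ⟨0, fun n _ y => right_ideal_mul_mem I hr _⟩)
      (fun r ih x => ?_) r
    choose N hN using fun z => ih _ (hw x z) z
    obtain ⟨J, hJ, hJI⟩ := exists_mul_mem I hI r
    have hfin := tendsto_zero_iff.1 (w x).2 J hJ
    refine ⟨hfin.toFinset.sup N + 1, fun n hn y => ?_⟩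
    obtain ⟨n, rfl⟩ := Nat.exists_eq_add_of_le' (le_add_self.trans hn)
    have h1 : iterate w (n + 1) x = bind (w x) (iterate w n) := by
      have := bind_bind_iterate w (single x) n
      rw [single_bind, single_bind] at this
      exact this.symm
    rw [h1]
    change r * ∑' z, (w x).1 z * (iterate w n z).1 y ∈ I
    rw [← (summable_bind (w x) _).tsum_mul_left]
    refine tsum_mem_of_isClosed (isClosed_right_ideal hI) fun z => ?_
    rw [← mul_assoc]
    by_cases hz : (w x).1 z ∈ J
    · exact right_ideal_mul_mem I (hJI _ hz) _
    · exact hN z n ((Finset.le_sup (f := N) (hfin.mem_toFinset.2 hz)).trans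
        (Nat.le_of_succ_le_succ hn)) y
  obtain ⟨N, hN⟩ := key 1 x
  exact ⟨N, fun n hn y => by simpa using hN n hn y⟩

/-- The invertibility of `1 - w` for a substitution `w` with coefficients in a topologically
T-nilpotent ideal. -/
theorem exists_sub_bind_eq_single {H : Ideal R} (hH : IsTopologicallyLeftTNilpotent H) {X : Type*}
    {w : X → FormalSum R X} (hw : ∀ x, w x ∈ coeffsIn H.toAddSubgroup X) (x : X) :
    ∃ v : FormalSum R X, v - bind v w = single x := by
  have h0 := iterate_convergesTo_zero hH hw x
  -- Partial sums of the geometric series for the inverse of `1 - w`.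
  let s : ℕ → FormalSum R X := fun n => ∑ i ∈ Finset.range n, iterate w i x
  have hs : ∃ v, ConvergesTo s v := by
    refine exists_convergesTo fun I hI => ?_
    obtain ⟨N, hN⟩ := h0 I hI
    simp only [sub_zero] at hN
    refine ⟨N, fun n hn => ?_⟩
    induction n, hn using Nat.le_induction with
    | base => rw [sub_self]; exact zero_mem _
    | succ n hn ih =>
      change ∑ i ∈ Finset.range (n + 1), _ - _ ∈ _
      rw [Finset.sum_range_succ, add_sub_right_comm]
      exact add_mem ih (hN n hn)
  obtain ⟨v, hv⟩ := hs
  refine ⟨v, (hv.sub (hv.bind_left w)).unique ?_⟩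
  have h1 : ∀ n, s n - bind (s n) w = single x - iterate w n x := fun n => by
    induction n with
    | zero => simp [s, bind_zero, iterate]
    | succ n ih =>
      have : s (n + 1) = s n + iterate w n x := Finset.sum_range_succ _ _
      rw [this, bind_add, add_sub_add_comm, ih]
      change _ + (_ - iterate w (n + 1) x) = _
      abel
  simp only [h1]
  simpa using (convergesTo_const (single x)).sub h0

variable {H : Ideal R}

/-- The Nakayama lemma: a morphism of contramodules which is surjective modulo a topologically
T-nilpotent ideal is surjective. -/
theorem LeftContramodule.surjective_of_sub_mem (hH : IsTopologicallyLeftTNilpotent H)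
    {F : LeftContramodule R} {f : F → F}
    (hf : ∀ r : FormalSum R F, f (F.act r) = F.act (FormalSum.map f r))
    (h : ∀ x, x - f x ∈ F.contraSpan H.toAddSubgroup) : Function.Surjective f := by
  choose w hw hwf using h
  intro x
  obtain ⟨v, hv⟩ := exists_sub_bind_eq_single hH hw x
  refine ⟨F.act v, ?_⟩
  have h1 : F.act (bind v fun y => single y - w y) = F.act (FormalSum.map f v) := by
    rw [act_bind]
    simp only [act_sub, F.act_single, hwf, sub_sub_cancel]
  rw [bind_sub_right, bind_single, hv, F.act_single] at h1
  rw [hf, h1]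

end TNilpotent

end ContramoduleTheory

namespace ContramoduleTheory

open Filter Topology TensorProduct

set_option linter.unusedSectionVars false

open FormalSum MulOpposite

variable {R : Type u} [Ring R] [TopologicalSpace R] [IsContramoduleRing R]

/-! ### Discrete right modules -/

section Discrete

variable {N : Type*} [AddCommGroup N] [Module Rᵐᵒᵖ N]

/-- The annihilator of an element of a right module. -/
def annihilatorOf (b : N) : Submodule Rᵐᵒᵖ R where
  carrier := {r | op r • b = 0}
  zero_mem' := by simp
  add_mem' {r s} hr hs := by
    rw [Set.mem_ofPred_eq] at *
    rw [MulOpposite.op_add, add_smul, hr, hs, add_zero]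
  smul_mem' c r hr := by
    rw [Set.mem_ofPred_eq] at *
    have : op (c • r) = c * op r := rfl
    rw [this, mul_smul, hr, smul_zero]

theorem isOpen_annihilatorOf [IsDiscreteRightModule R N] (b : N) :
    IsOpen ((annihilatorOf b : Submodule Rᵐᵒᵖ R) : Set R) :=
  IsDiscreteRightModule.isOpen_annihilator b

instance [IsDiscreteRightModule R N] (L : Submodule Rᵐᵒᵖ N) : IsDiscreteRightModule R L where
  isOpen_annihilator b := by
    have := IsDiscreteRightModule.isOpen_annihilator (R := R) (b : N)
    simpa only [← Submodule.coe_smul, Submodule.coe_eq_zero] using this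

instance [IsDiscreteRightModule R N] (L : Submodule Rᵐᵒᵖ N) :
    IsDiscreteRightModule R (N ⧸ L) where
  isOpen_annihilator b := by
    obtain ⟨b, rfl⟩ := L.mkQ_surjective b
    refine AddSubgroup.isOpen_mono (H₁ := (annihilatorOf (R := R) b).toAddSubgroup)
      (H₂ := (annihilatorOf (R := R) (L.mkQ b)).toAddSubgroup) (fun r hr => ?_)
      (isOpen_annihilatorOf b)
    change op r • L.mkQ b = 0
    rw [← map_smul, show op r • b = 0 from hr, map_zero]

theorem isDiscreteRightModule_quotient {I : Submodule Rᵐᵒᵖ R} (hI : IsOpen (I : Set R)) :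
    IsDiscreteRightModule R (R ⧸ I) where
  isOpen_annihilator b := by
    obtain ⟨b, rfl⟩ := I.mkQ_surjective b
    have h : {r : R | op r • I.mkQ b = 0} = (fun r => b * r) ⁻¹' (I : Set R) := by
      ext r
      rw [Set.mem_ofPred_eq, ← map_smul, Submodule.mkQ_apply, Submodule.Quotient.mk_eq_zero]
      rfl
    rw [h]
    exact hI.preimage (continuous_const_mul b)

theorem IsTopologicallyLeftTNilpotent.discrete_induction [IsDiscreteRightModule R N] {H : Ideal R}
    (hH : IsTopologicallyLeftTNilpotent H) {P : N → Prop} (zero : P 0)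
    (step : ∀ b, (∀ h ∈ H, P (op h • b)) → P b) (b : N) : P b := by
  have := hH.induction (isOpen_annihilatorOf b) (P := fun r => P (op r • b))
    (fun r (hr : op r • b = 0) => by rwa [hr])
    (fun r ih => step _ fun h hh => by simpa [mul_smul] using ih h hh) 1
  simpa using this

variable [IsDiscreteRightModule R N] {X Y : Type*}

/-- The annihilator of `b` is open, hence closed, so it contains the sum of the terms outside `s`.
-/
theorem op_tsum_smul (b : N) {ι : Type*} {f : ι → R} (hf : Summable f) (s : Finset ι)
    (hs : ∀ i ∉ s, op (f i) • b = 0) : op (∑' i, f i) • b = ∑ i ∈ s, op (f i) • b := by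
  have h : ∑' i, f i - ∑ i ∈ s, f i ∈ (annihilatorOf b : Submodule Rᵐᵒᵖ R) := by
    refine (isClosed_right_ideal (isOpen_annihilatorOf b)).mem_of_tendsto
      (hf.hasSum.sub_const (∑ i ∈ s, f i)) ?_
    filter_upwards [eventually_ge_atTop s] with t ht
    classical
    rw [← Finset.sum_sdiff ht, add_sub_cancel_right]
    exact sum_mem fun i hi => hs i (Finset.mem_sdiff.1 hi).2
  have h' : op (∑' i, f i - ∑ i ∈ s, f i) • b = 0 := h
  rw [MulOpposite.op_sub, sub_smul, sub_eq_zero] at h'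
  rw [h', Finset.op_sum, Finset.sum_smul]

/-- The finite formal linear combination `∑ (b rₓ) x` for `b` in a discrete module. -/
noncomputable def rowSmul (b : N) : FormalSum R X →+ (X →₀ N) :=
  AddMonoidHom.mk' (fun r => Finsupp.ofSupportFinite (fun x => op (r.1 x) • b)
    (finite_support_smul b r)) fun r s => Finsupp.ext fun x => by
      change op (r.1 x + s.1 x) • b = op (r.1 x) • b + op (s.1 x) • b
      rw [MulOpposite.op_add, add_smul]

theorem rowSmul_apply (b : N) (r : FormalSum R X) (x : X) : rowSmul b r x = op (r.1 x) • b := rfl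

/-- The action of a substitution `α : Y → R[[X]]` on finite formal linear combinations with
coefficients in a discrete module. -/
noncomputable def substAct (α : Y → FormalSum R X) : (Y →₀ N) →+ (X →₀ N) :=
  Finsupp.liftAddHom fun y => AddMonoidHom.mk' (fun b : N => rowSmul b (α y)) fun _ _ =>
    Finsupp.ext fun _ => smul_add _ _ _

theorem substAct_single (α : Y → FormalSum R X) (y : Y) (b : N) :
    substAct α (Finsupp.single y b) = rowSmul b (α y) :=
  Finsupp.liftAddHom_apply_single _ y b

theorem substAct_apply (α : Y → FormalSum R X) (z : Y →₀ N) (x : X) :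
    substAct α z x = ∑ y ∈ z.support, op ((α y).1 x) • z y := by
  rw [substAct, Finsupp.liftAddHom_apply, Finsupp.sum, Finsupp.finsetSum_apply]
  rfl

theorem substAct_rowSmul (α : Y → FormalSum R X) (b : N) (r : FormalSum R Y) :
    substAct α (rowSmul b r) = rowSmul b (bind r α) := by
  ext x
  rw [substAct_apply, rowSmul_apply]
  change _ = op (∑' y, r.1 y * (α y).1 x) • b
  rw [op_tsum_smul b (summable_bind r _) (rowSmul b r).support]
  · simp only [op_mul, mul_smul, rowSmul_apply]
  · intro y hy
    rw [op_mul, mul_smul, ← rowSmul_apply b r, Finsupp.notMem_support_iff.1 hy, smul_zero]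

theorem substAct_iterate_rowSmul (α : X → FormalSum R X) (b : N) (r : FormalSum R X) (n : ℕ) :
    (substAct α)^[n] (rowSmul b r) = rowSmul b (bind r (FormalSum.iterate α n)) := by
  induction n with
  | zero => rw [bind_iterate_zero]; rfl
  | succ n ih => rw [Function.iterate_succ_apply', ih, substAct_rowSmul, bind_iterate_succ]

theorem substAct_mapRange {M : Type*} [AddCommGroup M] [Module Rᵐᵒᵖ M] [IsDiscreteRightModule R M]
    (f : N →ₗ[Rᵐᵒᵖ] M) (α : Y → FormalSum R X) (z : Y →₀ N) :
    substAct α (Finsupp.mapRange.addMonoidHom f.toAddMonoidHom z) =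
      Finsupp.mapRange.addMonoidHom f.toAddMonoidHom (substAct α z) := by
  have h : (substAct α).comp (Finsupp.mapRange.addMonoidHom f.toAddMonoidHom) =
      (Finsupp.mapRange.addMonoidHom f.toAddMonoidHom).comp (substAct α) := by
    refine Finsupp.addHom_ext fun y b => ?_
    simp only [AddMonoidHom.comp_apply, Finsupp.mapRange.addMonoidHom_apply,
      Finsupp.mapRange_single, substAct_single]
    ext x
    simp [rowSmul_apply]
  exact DFunLike.congr_fun h z

end Discrete

/-! ### Finite formal linear combinations and the contratensor product -/

section Contratensor

variable {N : Type u} [AddCommGroup N] [Module Rᵐᵒᵖ N] [IsDiscreteRightModule R N]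
  (C : LeftContramodule R)

/-- The map `∑ bₓ x ↦ ∑ bₓ ⊗ x`. -/
noncomputable def toTensor (N : Type u) [AddCommGroup N] (C : LeftContramodule R) :
    (C →₀ N) →+ N ⊗[ℤ] C :=
  Finsupp.liftAddHom fun c => AddMonoidHom.mk' (fun b => b ⊗ₜ c) fun a b => add_tmul a b c

theorem toTensor_single {M : Type u} [AddCommGroup M] (c : C) (b : M) :
    toTensor M C (Finsupp.single c b) = b ⊗ₜ c :=
  Finsupp.liftAddHom_apply_single _ c b

theorem toTensor_rowSmul (b : N) (r : FormalSum R C) :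
    toTensor N C (rowSmul b r) = ∑ᶠ c : C, (op (r.1 c) • b) ⊗ₜ[ℤ] c := by
  rw [toTensor, Finsupp.liftAddHom_apply, Finsupp.sum,
    finsum_eq_sum_of_support_subset (s := (rowSmul b r).support)]
  · rfl
  · intro c hc
    by_contra h
    have h' := Finsupp.notMem_support_iff.1 h
    rw [rowSmul_apply] at h'
    exact hc (by simp [h'])

/-- The class of `∑ bₓ ⊗ x` in the contratensor product. -/
noncomputable def toContratensor (N : Type u) [AddCommGroup N] [Module Rᵐᵒᵖ N]
    (C : LeftContramodule R) : (C →₀ N) →+ Contratensor N C :=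
  (QuotientAddGroup.mk' _).comp (toTensor N C)

theorem toContratensor_rowSmul (b : N) (r : FormalSum R C) :
    toContratensor N C (rowSmul b r) =
      toContratensor N C (Finsupp.single (C.act r) b) := by
  refine Eq.symm (sub_eq_zero.1 ?_)
  rw [← _root_.map_sub]
  refine (QuotientAddGroup.eq_zero_iff _).2 (AddSubgroup.subset_closure ⟨(b, r), ?_⟩)
  rw [_root_.map_sub, toTensor_single, toTensor_rowSmul]

theorem toContratensor_substAct {α : C → FormalSum R C} (hα : ∀ c, C.act (α c) = c)
    (z : C →₀ N) : toContratensor N C (substAct α z) = toContratensor N C z := by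
  have h : (toContratensor N C).comp (substAct α) = toContratensor N C :=
    Finsupp.addHom_ext fun c b => by
      rw [AddMonoidHom.comp_apply, substAct_single, toContratensor_rowSmul, hα]
  exact DFunLike.congr_fun h z

theorem contratensorMap_toContratensor {M : Type u} [AddCommGroup M] [Module Rᵐᵒᵖ M]
    (f : N →ₗ[Rᵐᵒᵖ] M) (z : C →₀ N) :
    contratensorMap C f (toContratensor N C z) =
      toContratensor M C (Finsupp.mapRange.addMonoidHom f.toAddMonoidHom z) := by
  have h : (contratensorMap C f).comp (toContratensor N C) =
      (toContratensor M C).comp (Finsupp.mapRange.addMonoidHom f.toAddMonoidHom) := by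
    refine Finsupp.addHom_ext fun c b => ?_
    simp only [AddMonoidHom.comp_apply, toContratensor, Finsupp.mapRange.addMonoidHom_apply,
      Finsupp.mapRange_single, toTensor_single]
    rfl
  exact DFunLike.congr_fun h z

variable {C}

theorem rowSmul_eq_of_sub_mem {X : Type*} {H : Ideal R} (hN : ∀ h ∈ H, ∀ b : N, op h • b = 0) (b : N)
    {r s : FormalSum R X} (h : r - s ∈ coeffsIn H.toAddSubgroup X) : rowSmul b r = rowSmul b s := by
  rw [← sub_eq_zero, ← _root_.map_sub]
  exact Finsupp.ext fun x => hN _ (h x) b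

/-- A substitution which is compatible with the contraaction modulo `H` acts through the
contratensor product on the linear combinations with coefficients in a module annihilated
by `H`. -/
theorem substAct_eq_zero_of_toContratensor_eq_zero {H : Ideal R}
    (hN : ∀ h ∈ H, ∀ b : N, op h • b = 0) {σ : C → FormalSum R C}
    (hσ : ∀ r : FormalSum R C, σ (C.act r) - bind r σ ∈ coeffsIn H.toAddSubgroup C) {z : C →₀ N}
    (hz : toContratensor N C z = 0) : substAct σ z = 0 := by
  have hσ' : ∀ (b : N) (r : FormalSum R C), rowSmul b (σ (C.act r)) = rowSmul b (bind r σ) :=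
    fun b r => rowSmul_eq_of_sub_mem hN b (hσ r)
  -- The map `b ⊗ c ↦ b σ(c)`. Although `σ` need not be additive, it is so modulo `H`, which `N`
  -- does not see: `c + d` is by definition the contraaction of `single c + single d`.
  let β : N ⊗[ℤ] C →+ (C →₀ N) :=
    TensorProduct.liftAddHom
      (AddMonoidHom.mk' (fun b => AddMonoidHom.mk' (fun c => rowSmul b (σ c)) fun c d => by
          change rowSmul b (σ (C.act _)) = _
          rw [hσ', bind_add, single_bind, single_bind, map_add])
        fun b b' => AddMonoidHom.ext fun c => Finsupp.ext fun x => smul_add _ _ _)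
      fun n b c => by rw [map_zsmul, map_zsmul]; rfl
  have hβ : ∀ z, β (toTensor N C z) = substAct σ z := fun z => by
    have h : β.comp (toTensor N C) = substAct σ := Finsupp.addHom_ext fun c b => by
      rw [AddMonoidHom.comp_apply, toTensor_single, substAct_single]
      rfl
    exact DFunLike.congr_fun h z
  have hrel : contratensorRelations N C ≤ β.ker := by
    rw [contratensorRelations, AddSubgroup.closure_le]
    rintro _ ⟨⟨b, r⟩, rfl⟩
    change β _ = 0
    rw [_root_.map_sub, ← toTensor_rowSmul, ← toTensor_single, hβ, hβ, substAct_single, substAct_rowSmul,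
      hσ', sub_self]
  rw [← hβ]
  exact hrel ((QuotientAddGroup.eq_zero_iff _).1 hz)

/-- For a flat contramodule `F`, a substitution `α` over the contraaction of `F` which is
compatible with the contraaction modulo a topologically T-nilpotent ideal is locally nilpotent on
the kernel of the map from the finite linear combinations to the contratensor product. -/
theorem exists_substAct_iterate_eq_zero {H : Ideal R} [H.IsTwoSided]
    (hH : IsTopologicallyLeftTNilpotent H) {F : LeftContramodule R} (hF : F.IsFlat)
    {α : F → FormalSum R F} (hact : ∀ x, F.act (α x) = x)
    (hα : ∀ r : FormalSum R F, α (F.act r) - bind r α ∈ coeffsIn H.toAddSubgroup F) (z : F →₀ N)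
    (hz : toContratensor N F z = 0) : ∃ n, (substAct α)^[n] z = 0 := by
  -- Zorn's lemma applies because `z` has finite support, so its coefficients lie in one member of a
  -- chain.
  let S : Set (Submodule Rᵐᵒᵖ N) := {L | ∀ z : F →₀ N, (∀ x, z x ∈ L) →
    toContratensor N F z = 0 → ∃ n, (substAct α)^[n] z = 0}
  have hbot : ⊥ ∈ S := fun z hz _ => ⟨0, Finsupp.ext fun x => hz x⟩
  have hchain : ∀ c ⊆ S, IsChain (· ≤ ·) c → ∀ y ∈ c, ∃ ub ∈ S, ∀ z ∈ c, z ≤ ub := by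
    intro c hcS hc L₀ hL₀
    refine ⟨sSup c, fun z hz => ?_, fun L hL => le_sSup hL⟩
    have hfin : ∀ s : Finset F, ∃ L ∈ c, ∀ x ∈ s, z x ∈ L := by
      classical
      intro s
      induction s using Finset.induction_on with
      | empty => exact ⟨L₀, hL₀, by simp⟩
      | insert a s _ ih =>
        obtain ⟨L, hL, hLs⟩ := ih
        obtain ⟨L', hL', haL'⟩ :=
          (Submodule.mem_sSup_of_directed ⟨L₀, hL₀⟩ hc.directedOn).1 (hz a)
        obtain ⟨M, hM, h1, h2⟩ := hc.directedOn L hL L' hL'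
        refine ⟨M, hM, fun x hx => ?_⟩
        rcases Finset.mem_insert.1 hx with rfl | hx
        · exact h2 haL'
        · exact h1 (hLs x hx)
    obtain ⟨L, hL, hLs⟩ := hfin z.support
    refine hcS hL z fun x => ?_
    by_cases hx : x ∈ z.support
    · exact hLs x hx
    · rw [Finsupp.notMem_support_iff.1 hx]; exact L.zero_mem
  obtain ⟨L, -, hLS, hmax⟩ := zorn_le_nonempty₀ S hchain ⊥ hbot
  -- The largest submodule with `L'H ⊆ L`. Showing that it belongs to `S` forces `L' = L` by
  -- maximality.
  let L' : Submodule Rᵐᵒᵖ N :=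
    { carrier := {b | ∀ h ∈ H, op h • b ∈ L}
      zero_mem' := fun h _ => by rw [smul_zero]; exact L.zero_mem
      add_mem' := fun ha hb h hh => by rw [smul_add]; exact L.add_mem (ha h hh) (hb h hh)
      smul_mem' := fun c b hb h hh => by
        rw [← mul_smul]
        exact hb _ (H.mul_mem_left c.unop hh) }
  have hLL' : L ≤ L' := fun b hb h _ => L.smul_mem _ hb
  have hL'S : L' ∈ S := by
    intro z hzL' hz
    let z' : F →₀ L' := Finsupp.ofSupportFinite (fun x => ⟨z x, hzL' x⟩)
      (z.hasFiniteSupport.subset fun x hx h => hx (Subtype.ext h))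
    have hz' : Finsupp.mapRange.addMonoidHom L'.subtype.toAddMonoidHom z' = z :=
      Finsupp.ext fun x => rfl
    -- The only use of flatness: the class of `z` is zero already in `L' ⊙ F`, hence also in `(L' ⧸
    -- L) ⊙ F`.
    have hinj := (hF L' N (N ⧸ L') L'.subtype L'.mkQ L'.injective_subtype
      (LinearMap.exact_subtype_mkQ L') L'.mkQ_surjective).1
    have h1 : toContratensor L' F z' = 0 := by
      apply hinj
      rw [contratensorMap_toContratensor, hz', hz, map_zero]
    let M := L.submoduleOf L'
    have hM : ∀ h ∈ H, ∀ b : L' ⧸ M, op h • b = 0 := fun h hh b => by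
      obtain ⟨b, rfl⟩ := M.mkQ_surjective b
      rw [← map_smul, Submodule.mkQ_apply, Submodule.Quotient.mk_eq_zero]
      exact b.2 h hh
    have h2 : substAct α (Finsupp.mapRange.addMonoidHom M.mkQ.toAddMonoidHom z') = 0 := by
      refine substAct_eq_zero_of_toContratensor_eq_zero hM hα ?_
      rw [← contratensorMap_toContratensor, h1, map_zero]
    rw [substAct_mapRange] at h2
    have h3 : ∀ x, substAct α z x ∈ L := fun x => by
      have h4 : M.mkQ (substAct α z' x) = 0 := DFunLike.congr_fun h2 x
      rw [Submodule.mkQ_apply, Submodule.Quotient.mk_eq_zero] at h4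
      rw [← hz', substAct_mapRange]
      exact h4
    obtain ⟨n, hn⟩ := hLS _ h3 (by rw [toContratensor_substAct F hact, hz])
    exact ⟨n + 1, hn⟩
  have htop : ∀ b : N, b ∈ L :=
    hH.discrete_induction L.zero_mem fun b hb => hmax hL'S hLL' hb
  exact hLS z (fun x => htop _) hz

/-- Local nilpotency is applied to `N = R ⧸ I` and the coefficients of `k` modulo `I`, whose class
is that of `1 ⊗ act k = 0`. Once an iterate has its coefficients in the right ideal `I`, so do all
later ones. -/
theorem bind_iterate_convergesTo_zero {H : Ideal R} [H.IsTwoSided]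
    (hH : IsTopologicallyLeftTNilpotent H) {F : LeftContramodule R} (hF : F.IsFlat)
    {α : F → FormalSum R F} (hact : ∀ x, F.act (α x) = x)
    (hα : ∀ r : FormalSum R F, α (F.act r) - bind r α ∈ coeffsIn H.toAddSubgroup F)
    {k : FormalSum R F} (hk : F.act k = 0) :
    ConvergesTo (fun n => bind k (FormalSum.iterate α n)) 0 := by
  intro I hI
  have := isDiscreteRightModule_quotient hI
  have h0 : toContratensor (R ⧸ I) F (rowSmul (I.mkQ 1) k) = 0 := by
    have h : toTensor (R ⧸ I) F (Finsupp.single 0 (I.mkQ 1)) = 0 := by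
      rw [toTensor_single, tmul_zero]
    rw [toContratensor_rowSmul, hk, toContratensor, AddMonoidHom.comp_apply, h, map_zero]
  obtain ⟨n, hn⟩ := exists_substAct_iterate_eq_zero hH hF hact hα _ h0
  refine ⟨n, fun m hm => ?_⟩
  rw [sub_zero]
  refine bind_iterate_mem_of_le α hI hm fun x => ?_
  rw [substAct_iterate_rowSmul] at hn
  have h1 : op ((bind k (FormalSum.iterate α n)).1 x) • I.mkQ 1 = 0 := DFunLike.congr_fun hn x
  rw [← map_smul, Submodule.mkQ_apply, Submodule.Quotient.mk_eq_zero] at h1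
  simpa using h1

end Contratensor

end ContramoduleTheory

/-! ### Lifting the section from the reduction and correcting it by a limit. -/

namespace ContramoduleTheory

open Filter Topology TensorProduct

namespace LeftContramodule

open FormalSum

variable {R : Type u} [Ring R] [TopologicalSpace R] [IsContramoduleRing R]

theorem mem_coeffsIn_iff_coeffQuotient_eq {H : Ideal R} [H.IsTwoSided] [IsStronglyClosed H]
    {X : Type*} {r s : FormalSum R X} :
    r - s ∈ coeffsIn H.toAddSubgroup X ↔ coeffQuotient H r = coeffQuotient H s :=
  ⟨fun h => FormalSum.ext fun x => Ideal.Quotient.eq.2 (h x),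
    fun h x => Ideal.Quotient.eq.1 (congrFun (congrArg Subtype.val h) x)⟩

/-- A section of the contraaction of the reduction lifts to a map `α : F → R[[F]]` over the
contraaction of `F`, which is a morphism modulo `H`. -/
theorem exists_lift_of_projective_reduction (H : Ideal R) [H.IsTwoSided] [IsStronglyClosed H]
    (F : LeftContramodule R) (hF : CategoryTheory.Projective (F.reduction H)) :
    ∃ α : F → FormalSum R F, (∀ x, F.act (α x) = x) ∧
      ∀ r : FormalSum R F, α (F.act r) - bind r α ∈ coeffsIn H.toAddSubgroup F := by
  obtain ⟨e, he, hec⟩ : ∃ e : F.ReductionCarrier H → FormalSum (R ⧸ H) (F.ReductionCarrier H),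
      (∀ r, e (F.reductionAct H r) = bind r e) ∧ ∀ c, F.reductionAct H (e c) = c :=
    (projective_iff_exists_section _).1 hF
  let q := F.toReduction H
  have hq := F.toReduction_surjective H
  have hτ : ∀ c, q (Function.surjInv hq c) = c := Function.surjInv_eq hq
  -- The formal variables of `e (q x)` are lifted along `q`, then its coefficients by strong
  -- closedness. Since the lift of variables depends only on `q x`, compatibility modulo `H` holds
  -- in `(R ⧸ H)[[F]]`, not merely over the reduction of `F`.
  choose σ hσ using fun x : F =>
    coeffQuotient_surjective H (FormalSum.map (Function.surjInv hq) (e (q x)))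
  have hact : ∀ x, x - F.act (σ x) ∈ F.idealContraSpan H := fun x => by
    have h1 : F.pushSum H (σ x) = e (q x) := by
      rw [pushSum, coeffQuotient_map, hσ, FormalSum.map_map]
      refine (congrArg (fun f => FormalSum.map f (e (q x))) (funext hτ)).trans ?_
      exact FormalSum.map_id _
    have h2 : q (F.act (σ x)) = q x := by
      refine (F.reductionAct_pushSum H _).symm.trans ?_
      rw [h1]
      exact hec (q x)
    refine (QuotientAddGroup.eq_zero_iff _).1 ?_
    change q (x - _) = 0
    rw [_root_.map_sub, h2, sub_self]
  -- A correction with coefficients in `H` makes the contraaction of `σ x + w x` exactly `x` and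
  -- does not affect anything modulo `H`.
  choose w hw hwact using hact
  have hα : ∀ x, coeffQuotient H (σ x + w x) =
      FormalSum.map (Function.surjInv hq) (e (q x)) := fun x => by
    rw [← hσ, ← mem_coeffsIn_iff_coeffQuotient_eq, add_sub_cancel_left]
    exact hw x
  refine ⟨fun x => σ x + w x, fun x => ?_, fun r => ?_⟩
  · rw [act_add, hwact, add_sub_cancel]
  · rw [mem_coeffsIn_iff_coeffQuotient_eq, coeffQuotient_bind]
    simp only [hα]
    have h1 : q (F.act r) = F.reductionAct H (F.pushSum H r) := (F.reductionAct_pushSum H r).symm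
    rw [h1, he, FormalSum.map_bind, pushSum, coeffQuotient_map]
    exact bind_map _ _ _

/-- The limit of the iterates of `α` is a morphism. That it is a section cannot be read off from
`act (iterate α n x) = x`, as the contraaction need not respect limits; Nakayama's lemma and
idempotency replace continuity. -/
theorem projective_of_lift {H : Ideal R} [H.IsTwoSided] [IsStronglyClosed H]
    (hH : IsTopologicallyLeftTNilpotent H) {F : LeftContramodule R} (hF : F.IsFlat)
    {α : F → FormalSum R F} (hact : ∀ x, F.act (α x) = x)
    (hα : ∀ r : FormalSum R F, α (F.act r) - bind r α ∈ coeffsIn H.toAddSubgroup F) :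
    CategoryTheory.Projective F := by
  have hker : ∀ k : FormalSum R F, F.act k = 0 →
      ConvergesTo (fun n => bind k (FormalSum.iterate α n)) 0 :=
    fun k hk => bind_iterate_convergesTo_zero hH hF hact hα hk
  have hact_bind : ∀ r : FormalSum R F, F.act (bind r α) = F.act r := fun r => by
    rw [act_bind]
    simp only [hact]
    rw [FormalSum.map_id]
  have hact_iter : ∀ n x, F.act (FormalSum.iterate α n x) = x := fun n x => by
    induction n with
    | zero => exact F.act_single x
    | succ n ih => exact (hact_bind _).trans ih
  have hlim : ∀ x, ∃ l, ConvergesTo (fun n => FormalSum.iterate α n x) l := fun x => by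
    refine exists_convergesTo fun I hI => ?_
    -- Consecutive iterates differ by the `n`-th iterate applied to `α x - single x`, which lies in
    -- the kernel of the contraaction.
    obtain ⟨N, hN⟩ := hker (α x - single x) (by rw [act_sub, hact, F.act_single, sub_self]) I hI
    refine ⟨N, fun n hn => ?_⟩
    induction n, hn using Nat.le_induction with
    | base => rw [sub_self]; exact zero_mem _
    | succ n hn ih =>
      have h1 : bind (α x - single x) (FormalSum.iterate α n) - 0 ∈ _ := hN n hn
      have h2 : bind (α x) (FormalSum.iterate α n) = FormalSum.iterate α (n + 1) x := by
        rw [← single_bind x α, bind_bind_iterate, single_bind]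
      rw [sub_zero, bind_sub, single_bind, h2] at h1
      simpa using add_mem h1 ih
  choose e he using hlim
  have hker_e : ∀ k : FormalSum R F, F.act k = 0 → bind k e = 0 := fun k hk =>
    (ConvergesTo.bind_right k he).unique (hker k hk)
  have hcongr : ∀ r s : FormalSum R F, F.act r = F.act s → bind r e = bind s e := fun r s h => by
    rw [← sub_eq_zero, ← bind_sub]
    exact hker_e _ (by rw [act_sub, h, sub_self])
  have he_hom : ∀ r : FormalSum R F, e (F.act r) = bind r e := fun r => by
    rw [← single_bind (F.act r) e]
    exact hcongr _ _ (F.act_single _)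
  have he_idem : ∀ x, bind (e x) e = e x := fun x => by
    refine ((he x).bind_left e).unique ?_
    have h1 : ∀ n, bind (FormalSum.iterate α n x) e = e x := fun n => by
      rw [hcongr _ (single x) (by rw [hact_iter, F.act_single]), single_bind]
    simp only [h1]
    exact convergesTo_const _
  -- Modulo `H` the map `α` is a morphism over the contraaction, so `α` applied to the `n`-th
  -- iterate at `x` is `α (act (iterate α n x)) = α x`. Closedness of `H` then passes this to the
  -- limit `e`.
  have hα_idem : ∀ n x, FormalSum.iterate α (n + 1) x - α x ∈ coeffsIn H.toAddSubgroup F := by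
    intro n x
    rw [mem_coeffsIn_iff_coeffQuotient_eq]
    have h := mem_coeffsIn_iff_coeffQuotient_eq.1 (hα (FormalSum.iterate α n x))
    rw [hact_iter] at h
    exact h.symm
  have he_mod : ∀ x, e x - α x ∈ coeffsIn H.toAddSubgroup F := fun x => by
    refine mem_coeffsIn_of_isClosed (IsStronglyClosed.isClosed (H := H)) fun I hI => ?_
    obtain ⟨N, hN⟩ := he x I hI
    refine ⟨_, hα_idem N x, ?_⟩
    rw [sub_sub_sub_cancel_right, ← neg_sub]
    exact neg_mem (hN (N + 1) N.le_succ)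
  let θ : F → F := fun x => F.act (e x)
  have hθ_surj : Function.Surjective θ := by
    refine surjective_of_sub_mem hH (fun r => ?_) fun x => ?_
    · change F.act (e (F.act r)) = _
      rw [he_hom, act_bind]
    · refine ⟨α x - e x, ?_, ?_⟩
      · rw [← neg_sub]
        exact neg_mem (he_mod x)
      · rw [act_sub, hact]
  -- A surjective idempotent map is the identity.
  have hθ : ∀ x, θ x = x := fun x => by
    obtain ⟨y, rfl⟩ := hθ_surj x
    change F.act (e (F.act (e y))) = _
    rw [he_hom, he_idem]
  exact (projective_iff_exists_section F).2 ⟨e, he_hom, hθ⟩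

end LeftContramodule

end ContramoduleTheory

theorem theorem8p3 {R : Type u} [Ring R] [TopologicalSpace R]
    [ContramoduleTheory.IsContramoduleRing R]
    (H : Ideal R) [H.IsTwoSided] [ContramoduleTheory.IsStronglyClosed H]
    (hH : ContramoduleTheory.IsTopologicallyLeftTNilpotent H)
    (F : ContramoduleTheory.LeftContramodule R) (hF : F.IsFlat) :
    CategoryTheory.Projective F ↔ CategoryTheory.Projective (F.reduction H) := by
  refine ⟨F.projective_reduction H, fun h => ?_⟩
  obtain ⟨α, hact, hα⟩ := F.exists_lift_of_projective_reduction H h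
  exact ContramoduleTheory.LeftContramodule.projective_of_lift hH hF hact hα
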